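/- **Cubature rule for $G_2$.** For $a=(a_1,a_2)\in\mathbb{R}^2$ put $$X_1(a)=2\bigl(\cos 2\pi a_1+\cos 2\pi(a_1-3a_2)+\cos 2\pi(2a_1-3a_2)\bigr),$$ $$X_2(a)=2\bigl(\cos 2\pi a_2+\cos 2\pi(a_1-a_2)+\cos 2\pi(a_1-2a_2)\bigr).$$ Let $$\Omega=\Bigl\{(y_1,y_2)\in\mathbb{R}^2 : y_2\ge -3,\ -2\bigl((y_2+3)^{3/2}+3y_2+6\bigr)\le y_1\le 2\bigl((y_2+3)^{3/2}-3y_2-6\bigr),\ y_1\ge \tfrac14 y_2^2-3\Bigr\},$$ $$K(y_1,y_2)=(y_2^2-4y_1-12)(y_1^2-4y_2^3+12y_1y_2+24y_1+36y_2+36).$$ For an integer $M\ge 1$ let $$I_M=\{(s_0,s_1,s_2)\in(\mathbb{Z}^{\ge 0})^3 : s_0+2s_1+3s_2=M\},$$ and for $j=(s_0,s_1,s_2)\in I_M$ let $$a^{(j)}=\Bigl(\frac{2s_1+3s_2}{M},\frac{s_1+2s_2}{M}\Bigr),\qquad y^{(j)}=\bigl(X_1(a^{(j)}),X_2(a^{(j)})\bigr).$$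 Let $W$ be the Weyl group of $G_2$ acting on $\mathbb{R}^2$ in coordinates with respect to the simple coroots $\alpha_1^\vee,\alpha_2^\vee$ (with $\alpha_1$ long and $\alpha_2$ short), that is, the group generated by $$r_1(a_1,a_2)=(-a_1+3a_2,\,a_2),\qquad r_2(a_1,a_2)=(a_1,\,a_1-a_2),$$ and let $\varepsilon_j$ be the number of points of the $W$-orbit of $a^{(j)}$ in the torus $\mathbb{R}^2/\mathbb{Z}^2$. For $N\ge 0$ let $\Pi_N$ be the space of polynomials $p\in\mathbb{C}[y_1,y_2]$ such that $3\lambda_1+2\lambda_2\le N$ for every monomial $y_1^{\lambda_1}y_2^{\lambda_2}$ that occurs in $p$. Then for every integer $M\ge 1$ and every $p\in\Pi_{2M-1}$ the function $pK^{-1/2}$ is integrable on $\Omega$, and $$\int_\Omega p(y_1,y_2)\,K(y_1,y_2)^{-1/2}\,dy_1\,dy_2=\frac{\pi^2}{3M^2}\sum_{j\in I_M}\varepsilon_j\,p\bigl(y^{(j)}\bigr).$$ -/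

import Mathlib

noncomputable section

namespace G2Cubature

/-! Points `x = a₁ α₁^∨ + a₂ α₂^∨` of the Euclidean plane are given by their coordinates
`a = (a₁, a₂)` in the basis of simple coroots of `G₂`, where
`⟨α₁, α₁⟩ = 2`, `⟨α₂, α₂⟩ = 2/3`, `⟨α₁, α₂⟩ = -1`, `α₁^∨ = α₁`, `α₂^∨ = 3 α₂`. -/

/-- The linear form `x ↦ ⟨x, α₁⟩`, i.e. `a ↦ 2 a₁ - 3 a₂` in coroot coordinates. -/
def rootForm₁ : Module.Dual ℝ (ℝ × ℝ) :=
  (2 : ℝ) • LinearMap.fst ℝ ℝ ℝ - (3 : ℝ) • LinearMap.snd ℝ ℝ ℝ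

/-- The linear form `x ↦ ⟨x, α₂⟩`, i.e. `a ↦ -a₁ + 2 a₂` in coroot coordinates. -/
def rootForm₂ : Module.Dual ℝ (ℝ × ℝ) :=
  -LinearMap.fst ℝ ℝ ℝ + (2 : ℝ) • LinearMap.snd ℝ ℝ ℝ

theorem rootForm₁_coroot₁ : rootForm₁ ((1, 0) : ℝ × ℝ) = 2 := by
  simp [rootForm₁]

theorem rootForm₂_coroot₂ : rootForm₂ ((0, 1) : ℝ × ℝ) = 2 := by
  simp [rootForm₂]

/-- The reflection `r₁ x = x - ⟨x, α₁⟩ α₁^∨`. -/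
def r₁ : (ℝ × ℝ) ≃ₗ[ℝ] (ℝ × ℝ) := Module.reflection rootForm₁_coroot₁

/-- The reflection `r₂ x = x - ⟨x, α₂⟩ α₂^∨`. -/
def r₂ : (ℝ × ℝ) ≃ₗ[ℝ] (ℝ × ℝ) := Module.reflection rootForm₂_coroot₂

theorem r₁_apply (a : ℝ × ℝ) : r₁ a = (-a.1 + 3 * a.2, a.2) := by
  ext <;> simp [r₁, Module.reflection_apply, rootForm₁]
  ring

theorem r₂_apply (a : ℝ × ℝ) : r₂ a = (a.1, a.1 - a.2) := by
  ext <;> simp [r₂, Module.reflection_apply, rootForm₂]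
  ring

/-- The Weyl group of `G₂`, generated by the two simple reflections. -/
def weylGroup : Subgroup ((ℝ × ℝ) ≃ₗ[ℝ] (ℝ × ℝ)) := Subgroup.closure {r₁, r₂}

/-- The projection to the torus `ℝ² / Q^∨`; in coroot coordinates `Q^∨` is `ℤ × ℤ`. -/
def toTorus (a : ℝ × ℝ) : UnitAddCircle × UnitAddCircle :=
  ((a.1 : UnitAddCircle), (a.2 : UnitAddCircle))

/-- `ε(x)`, the number of points of the Weyl group orbit of `x` in the torus `ℝ² / Q^∨`. -/
def orbitSize (a : ℝ × ℝ) : ℕ :=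
  Set.ncard {t : UnitAddCircle × UnitAddCircle | ∃ w ∈ weylGroup, toTorus (w a) = t}

/-- The orbit function of the first fundamental weight. -/
def X₁ (a : ℝ × ℝ) : ℝ :=
  2 * (Real.cos (2 * Real.pi * a.1) + Real.cos (2 * Real.pi * (a.1 - 3 * a.2))
    + Real.cos (2 * Real.pi * (2 * a.1 - 3 * a.2)))

/-- The orbit function of the second fundamental weight. -/
def X₂ (a : ℝ × ℝ) : ℝ :=
  2 * (Real.cos (2 * Real.pi * a.2) + Real.cos (2 * Real.pi * (a.1 - a.2))
    + Real.cos (2 * Real.pi * (a.1 - 2 * a.2)))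

/-- The integration domain; `-3 ≤ y₂` is the condition under which `(y₂ + 3) ^ (3/2)` is a
real number. -/
def Ω : Set (ℝ × ℝ) :=
  {y | -3 ≤ y.2
    ∧ -2 * ((y.2 + 3) ^ (3 / 2 : ℝ) + 3 * y.2 + 6) ≤ y.1
    ∧ y.1 ≤ 2 * ((y.2 + 3) ^ (3 / 2 : ℝ) - 3 * y.2 - 6)
    ∧ y.2 ^ 2 / 4 - 3 ≤ y.1}

/-- The weight polynomial `K`. -/
def K (y : ℝ × ℝ) : ℝ :=
  (y.2 ^ 2 - 4 * y.1 - 12)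
    * (y.1 ^ 2 - 4 * y.2 ^ 3 + 12 * y.1 * y.2 + 24 * y.1 + 36 * y.2 + 36)

/-- The index set `I_M` of triples `(s₀, s₁, s₂)`. -/
def indexSet (M : ℕ) : Finset (ℕ × ℕ × ℕ) :=
  (Finset.range (M + 1) ×ˢ Finset.range (M + 1) ×ˢ Finset.range (M + 1)).filter
    fun s => s.1 + 2 * s.2.1 + 3 * s.2.2 = M

theorem mem_indexSet (M : ℕ) (s : ℕ × ℕ × ℕ) :
    s ∈ indexSet M ↔ s.1 + 2 * s.2.1 + 3 * s.2.2 = M := by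
  simp only [indexSet, Finset.mem_filter, Finset.mem_product, Finset.mem_range]
  omega

/-- The grid point `(s₁/M) ω₁^∨ + (s₂/M) ω₂^∨`, where `ω₁^∨ = 2 α₁^∨ + α₂^∨` and
`ω₂^∨ = 3 α₁^∨ + 2 α₂^∨`. -/
def gridPoint (M : ℕ) (s : ℕ × ℕ × ℕ) : ℝ × ℝ :=
  ((2 * s.2.1 + 3 * s.2.2) / M, (s.2.1 + 2 * s.2.2) / M)

/-- The node `y^{(j)}`. -/
def node (M : ℕ) (j : ℕ × ℕ × ℕ) : ℝ × ℝ := (X₁ (gridPoint M j), X₂ (gridPoint M j))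

/-- The weight `ε_j`. -/
def ε (M : ℕ) (j : ℕ × ℕ × ℕ) : ℕ := orbitSize (gridPoint M j)

/-- The `m`-degree: the largest value of `3 λ₁ + 2 λ₂` over the monomials `y₁^λ₁ y₂^λ₂` that
occur in `p`. The weights are the dual marks of `G₂`: the highest dual root is
`3 α₁^∨ + 2 α₂^∨`. -/
def mDegree (p : MvPolynomial (Fin 2) ℂ) : ℕ := MvPolynomial.weightedTotalDegree ![3, 2] p

/-- `Π_N`, the complex polynomials of `m`-degree at most `N`. -/
def polySpace (N : ℕ) : Set (MvPolynomial (Fin 2) ℂ) := {p | mDegree p ≤ N}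

/-- The value of `p` at a real point. -/
def evalAt (p : MvPolynomial (Fin 2) ℂ) (y : ℝ × ℝ) : ℂ :=
  MvPolynomial.eval ![(y.1 : ℂ), (y.2 : ℂ)] p

end G2Cubature

end

noncomputable section

namespace G2Cubature

open Real MeasureTheory Set
open scoped ENNReal

/-! ### The orbit functions in terms of three cosines -/

/-! The orbit functions are symmetric polynomials in three cosines whose angles satisfy θ₁ + θ₂ =
θ₃. The numbers xᵢ = 2 cos θᵢ are the roots of a cubic with e₁ = y₂, e₂ = y₁ + y₂, and e₃ forced by
the relation among the cosines; `K` is the discriminant of this cubic. Hence `X` is injective on the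
alcove (`X_injOn`) with image `Ω` (`X_image_alcove`). The Jacobian of `X` is (2π)² times the same
Vandermonde product whose square is `K ∘ X`, so K^(-1/2) cancels it up to the constant 4π²
(`jacobian_mul_weight`). The weighted integral over `Ω` thus becomes a plain integral over the
alcove, which by affine Weyl invariance is 1/12 of the integral over the unit square
(`integral_unitSquare_comp_X`). On the torus, p ∘ X is a trigonometric polynomial whose degree,
measured by pairing weights with the long coroots, is at most 2M - 1. The M × M grid integrates such
functions exactly (`integral_eq_gridMean`). Finally the grid is grouped into Weyl orbits, each
meeting the alcove in exactly one grid point (`gridMean_comp_X`), which produces the weights ε and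
the constant 4π²/12 = π²/3. -/

/-- The cosine of the angle `2π (2 a₂ - a₁)`. -/
def c₁ (a : ℝ × ℝ) : ℝ := cos (2 * π * (2 * a.2 - a.1))

/-- The cosine of the angle `2π (a₁ - a₂)`. -/
def c₂ (a : ℝ × ℝ) : ℝ := cos (2 * π * (a.1 - a.2))

/-- The cosine of the angle `2π a₂`. -/
def c₃ (a : ℝ × ℝ) : ℝ := cos (2 * π * a.2)

theorem X₂_eq (a : ℝ × ℝ) : X₂ a = 2 * (c₁ a + c₂ a + c₃ a) := by
  have h : cos (2 * π * (a.1 - 2 * a.2)) = c₁ a := by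
    rw [c₁, ← cos_neg]; congr 1; ring
  rw [X₂, h, c₂, c₃]; ring

/-- Since θ₁ + θ₂ = θ₃, the product-to-sum formula splits each product of two of the cosines into
the third cosine and one term of `X₁`. -/
theorem X₁_eq (a : ℝ × ℝ) :
    X₁ a = 4 * (c₁ a * c₂ a + c₁ a * c₃ a + c₂ a * c₃ a) - 2 * (c₁ a + c₂ a + c₃ a) := by
  have key (x y z : ℝ) (h : x + y = z) : 2 * (cos x * cos y) = cos (x - y) + cos z := by
    rw [← h, cos_add, cos_sub]; ring
  have key' (x y z : ℝ) (h : x - y = z) : 2 * (cos x * cos y) = cos (x + y) + cos z := by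
    rw [← h, cos_add, cos_sub]; ring
  have h₁₂ := key (2 * π * (2 * a.2 - a.1)) (2 * π * (a.1 - a.2)) (2 * π * a.2) (by ring)
  have h₃₁ := key' (2 * π * a.2) (2 * π * (2 * a.2 - a.1)) (2 * π * (a.1 - a.2)) (by ring)
  have h₃₂ := key' (2 * π * a.2) (2 * π * (a.1 - a.2)) (2 * π * (2 * a.2 - a.1)) (by ring)
  rw [show 2 * π * (2 * a.2 - a.1) - 2 * π * (a.1 - a.2) = -(2 * π * (2 * a.1 - 3 * a.2)) by ring,
    cos_neg] at h₁₂
  rw [show 2 * π * a.2 + 2 * π * (2 * a.2 - a.1) = -(2 * π * (a.1 - 3 * a.2)) by ring,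
    cos_neg] at h₃₁
  rw [show 2 * π * a.2 + 2 * π * (a.1 - a.2) = 2 * π * a.1 by ring] at h₃₂
  rw [X₁, c₁, c₂, c₃]
  linear_combination -2 * h₁₂ - 2 * h₃₁ - 2 * h₃₂

theorem cos_relation (a : ℝ × ℝ) :
    c₁ a ^ 2 + c₂ a ^ 2 + c₃ a ^ 2 - 2 * c₁ a * c₂ a * c₃ a = 1 := by
  have h : c₃ a = c₁ a * c₂ a - sin (2 * π * (2 * a.2 - a.1)) * sin (2 * π * (a.1 - a.2)) := by
    rw [c₁, c₂, c₃, ← cos_add]; congr 1; ring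
  have h₁ : sin (2 * π * (2 * a.2 - a.1)) ^ 2 + c₁ a ^ 2 = 1 := sin_sq_add_cos_sq _
  have h₂ : sin (2 * π * (a.1 - a.2)) ^ 2 + c₂ a ^ 2 = 1 := sin_sq_add_cos_sq _
  rw [h]
  linear_combination (sin (2 * π * (a.1 - a.2)) ^ 2) * h₁ + (1 - c₁ a ^ 2) * h₂

/-- The point with coordinates `X₁ a`, `X₂ a`. -/
def X (a : ℝ × ℝ) : ℝ × ℝ := (X₁ a, X₂ a)

/-- The Vandermonde product of the three cosines. -/
def vdm (a : ℝ × ℝ) : ℝ := (c₁ a - c₂ a) * (c₁ a - c₃ a) * (c₂ a - c₃ a)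

/-- The hypothesis reads e₃ = e₁² - 2e₂ - 4. Substituting it into the discriminant of a monic cubic
gives a polynomial in e₁, e₂ that factors as `K`. -/
theorem K_eq_discrim (x₁ x₂ x₃ : ℝ) (h : x₁ ^ 2 + x₂ ^ 2 + x₃ ^ 2 - x₁ * x₂ * x₃ = 4) :
    K (x₁ * x₂ + x₁ * x₃ + x₂ * x₃ - (x₁ + x₂ + x₃), x₁ + x₂ + x₃)
      = ((x₁ - x₂) * (x₁ - x₃) * (x₂ - x₃)) ^ 2 := by
  obtain ⟨e₁, he₁⟩ : ∃ e, e = x₁ + x₂ + x₃ := ⟨_, rfl⟩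
  obtain ⟨e₂, he₂⟩ : ∃ e, e = x₁ * x₂ + x₁ * x₃ + x₂ * x₃ := ⟨_, rfl⟩
  have he₃ : x₁ * x₂ * x₃ = e₁ ^ 2 - 2 * e₂ - 4 := by rw [he₁, he₂]; linear_combination -h
  have hd : ((x₁ - x₂) * (x₁ - x₃) * (x₂ - x₃)) ^ 2
      = e₁ ^ 2 * e₂ ^ 2 - 4 * e₂ ^ 3 - 4 * e₁ ^ 3 * (x₁ * x₂ * x₃)
        + 18 * e₁ * e₂ * (x₁ * x₂ * x₃) - 27 * (x₁ * x₂ * x₃) ^ 2 := by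
    rw [he₁, he₂]; ring
  rw [hd, he₃, ← he₁, ← he₂, K]
  ring

theorem K_X (a : ℝ × ℝ) : K (X a) = (8 * vdm a) ^ 2 := by
  have h := K_eq_discrim (2 * c₁ a) (2 * c₂ a) (2 * c₃ a) (by linear_combination 4 * cos_relation a)
  have h' : X a = (2 * c₁ a * (2 * c₂ a) + 2 * c₁ a * (2 * c₃ a) + 2 * c₂ a * (2 * c₃ a)
      - (2 * c₁ a + 2 * c₂ a + 2 * c₃ a), 2 * c₁ a + 2 * c₂ a + 2 * c₃ a) := by
    rw [X, X₁_eq, X₂_eq]; ext <;> simp <;> ring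
  rw [h', h, vdm]; ring

/-! ### The fundamental alcove -/

/-- The closed fundamental alcove of the affine Weyl group. -/
def alcove : Set (ℝ × ℝ) := {a | 0 ≤ 2 * a.2 - a.1 ∧ 0 ≤ 2 * a.1 - 3 * a.2 ∧ a.1 ≤ 1}

theorem c₁_anti {a : ℝ × ℝ} (ha : a ∈ alcove) : c₂ a ≤ c₁ a := by
  obtain ⟨h₁, h₂, h₃⟩ := ha
  have := pi_pos
  apply cos_le_cos_of_nonneg_of_le_pi <;> nlinarith

theorem c₂_anti {a : ℝ × ℝ} (ha : a ∈ alcove) : c₃ a ≤ c₂ a := by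
  obtain ⟨h₁, h₂, h₃⟩ := ha
  have hp := pi_pos
  -- In the alcove the third angle can reach 4π/3; beyond π it is reflected to 2π - θ₃, and `a.1 ≤
  -- 1` is what keeps this above θ₂.
  rcases le_total a.2 (1 / 2) with h | h
  · apply cos_le_cos_of_nonneg_of_le_pi <;> nlinarith
  · rw [c₃, c₂, ← cos_two_pi_sub]
    apply cos_le_cos_of_nonneg_of_le_pi <;> nlinarith

theorem c₁_strictAnti {a : ℝ × ℝ} (h₁ : 0 < 2 * a.2 - a.1) (h₂ : 0 < 2 * a.1 - 3 * a.2)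
    (h₃ : a.1 < 1) : c₂ a < c₁ a := by
  have := pi_pos
  apply cos_lt_cos_of_nonneg_of_le_pi <;> nlinarith

theorem c₂_strictAnti {a : ℝ × ℝ} (h₁ : 0 < 2 * a.2 - a.1) (h₂ : 0 < 2 * a.1 - 3 * a.2)
    (h₃ : a.1 < 1) : c₃ a < c₂ a := by
  have hp := pi_pos
  rcases le_total a.2 (1 / 2) with h | h
  · apply cos_lt_cos_of_nonneg_of_le_pi <;> nlinarith
  · rw [c₃, c₂, ← cos_two_pi_sub]
    apply cos_lt_cos_of_nonneg_of_le_pi <;> nlinarith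

/-- A decreasing triple of reals is determined by its elementary symmetric functions. -/
theorem eq_of_symmetric_eq {x y z x' y' z' : ℝ} (hxy : y ≤ x) (hyz : z ≤ y) (hxy' : y' ≤ x')
    (hyz' : z' ≤ y') (h₁ : x + y + z = x' + y' + z')
    (h₂ : x * y + x * z + y * z = x' * y' + x' * z' + y' * z')
    (h₃ : x * y * z = x' * y' * z') : x = x' ∧ y = y' ∧ z = z' := by
  -- The common monic cubic is positive beyond its largest root `x`, so its root `x'` cannot exceed
  -- `x`. Negating both triples gives the same for the smallest root.
  have le_max {x y z x' y' z' : ℝ} (hxy : y ≤ x) (hyz : z ≤ y) (h₁ : x + y + z = x' + y' + z')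
      (h₂ : x * y + x * z + y * z = x' * y' + x' * z' + y' * z')
      (h₃ : x * y * z = x' * y' * z') : x' ≤ x := by
    by_contra! hlt
    have h : (x' - x) * (x' - y) * (x' - z) = 0 := by
      linear_combination -x' ^ 2 * h₁ + x' * h₂ - h₃
    have : 0 < (x' - x) * (x' - y) * (x' - z) :=
      mul_pos (mul_pos (by linarith) (by linarith)) (by linarith)
    exact this.ne' h
  have hx : x = x' :=
    le_antisymm (le_max hxy' hyz' h₁.symm h₂.symm h₃.symm) (le_max hxy hyz h₁ h₂ h₃)
  have hz : -z = -z' := le_antisymm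
    (le_max (x := -z') (y := -y') (z := -x') (x' := -z) (y' := -y) (z' := -x)
      (by linarith) (by linarith) (by linarith) (by linarith) (by linarith))
    (le_max (x := -z) (y := -y) (z := -x) (x' := -z') (y' := -y') (z' := -x')
      (by linarith) (by linarith) (by linarith) (by linarith) (by linarith))
  refine ⟨hx, ?_, ?_⟩ <;> linarith

/-- `X` fixes the first two symmetric functions of the cosines and `cos_relation` the third. The
cosines are sorted on the alcove, hence determined, and θ₁, θ₂ lie in [0, π], where the cosine is
injective. -/
theorem X_injOn : InjOn X alcove := by
  intro a ha b hb hab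
  have e₂ : X₂ a = X₂ b := congrArg Prod.snd hab
  have e₁ : X₁ a = X₁ b := congrArg Prod.fst hab
  rw [X₂_eq, X₂_eq] at e₂
  rw [X₁_eq, X₁_eq] at e₁
  have s₁ : c₁ a + c₂ a + c₃ a = c₁ b + c₂ b + c₃ b := by linarith
  have s₂ : c₁ a * c₂ a + c₁ a * c₃ a + c₂ a * c₃ a
      = c₁ b * c₂ b + c₁ b * c₃ b + c₂ b * c₃ b := by linarith
  have s₃ : c₁ a * c₂ a * c₃ a = c₁ b * c₂ b * c₃ b := by
    linear_combination -1 / 2 * cos_relation a + 1 / 2 * cos_relation b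
      + 1 / 2 * (c₁ a + c₂ a + c₃ a + (c₁ b + c₂ b + c₃ b)) * s₁ - s₂
  obtain ⟨h₁, h₂, -⟩ := eq_of_symmetric_eq (c₁_anti ha) (c₂_anti ha) (c₁_anti hb) (c₂_anti hb)
    s₁ s₂ s₃
  obtain ⟨p₁, p₂, p₃⟩ := ha
  obtain ⟨q₁, q₂, q₃⟩ := hb
  have hp := pi_pos
  have i₁ := injOn_cos (by constructor <;> nlinarith) (by constructor <;> nlinarith) h₁
  have i₂ := injOn_cos (by constructor <;> nlinarith) (by constructor <;> nlinarith) h₂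
  have j₁ := mul_left_cancel₀ (by positivity) i₁
  have j₂ := mul_left_cancel₀ (by positivity) i₂
  ext <;> linarith

/-! ### The image of the alcove -/

/-- The two bounds with exponent 3/2 say |y₁ + 6y₂ + 12| ≤ 2(y₂ + 3)^(3/2), and the second factor of
`K` is (y₁ + 6y₂ + 12)² - 4(y₂ + 3)³. Its nonpositivity already forces y₂ ≥ -3. -/
theorem mem_Ω_iff (y : ℝ × ℝ) : y ∈ Ω ↔ y.2 ^ 2 - 4 * y.1 - 12 ≤ 0 ∧
    y.1 ^ 2 - 4 * y.2 ^ 3 + 12 * y.1 * y.2 + 24 * y.1 + 36 * y.2 + 36 ≤ 0 := by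
  have pow_sq (h : -3 ≤ y.2) : ((y.2 + 3) ^ (3 / 2 : ℝ)) ^ 2 = (y.2 + 3) ^ 3 := by
    rw [← rpow_natCast, ← rpow_mul (by linarith), ← rpow_natCast]; norm_num
  constructor
  · rintro ⟨h₁, h₂, h₃, h₄⟩
    have := pow_sq h₁
    refine ⟨by linarith, ?_⟩
    nlinarith [mul_nonneg (sub_nonneg.2 h₂) (sub_nonneg.2 h₃)]
  · rintro ⟨h₁, h₂⟩
    have h₀ : -3 ≤ y.2 := by
      by_contra! h
      have : 0 < (-y.2 - 3) ^ 3 := by apply pow_pos; linarith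
      nlinarith [sq_nonneg (y.1 + 6 * y.2 + 12)]
    have h₃ := pow_sq h₀
    have h₄ : |y.1 + 6 * y.2 + 12| ≤ 2 * (y.2 + 3) ^ (3 / 2 : ℝ) := by
      apply abs_le_of_sq_le_sq _ (by have := rpow_nonneg (by linarith : 0 ≤ y.2 + 3) (3 / 2); linarith)
      rw [mul_pow, h₃]; nlinarith
    rw [abs_le] at h₄
    exact ⟨h₀, by linarith, by linarith, by linarith⟩

/-- The first factor of `K` is -8 ∏(1 - cᵢ) ≤ 0. Where it is negative, the second is nonpositive
because `K_X` makes the product a square. Where it vanishes, one cosine is 1 and the other two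
agree, and the second factor is the explicit one-variable polynomial in `edge`. -/
theorem X_mem_Ω (a : ℝ × ℝ) : X a ∈ Ω := by
  rw [mem_Ω_iff]
  have hr := cos_relation a
  have b₁ : c₁ a ≤ 1 := cos_le_one _
  have b₂ : c₂ a ≤ 1 := cos_le_one _
  have b₃ : c₃ a ≤ 1 := cos_le_one _
  have d₁ : -1 ≤ c₁ a := neg_one_le_cos _
  have d₂ : -1 ≤ c₂ a := neg_one_le_cos _
  have hK := K_X a
  have h₂ : (X a).2 = 2 * (c₁ a + c₂ a + c₃ a) := X₂_eq a
  have h₁ : (X a).1 = 4 * (c₁ a * c₂ a + c₁ a * c₃ a + c₂ a * c₃ a)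
    - 2 * (c₁ a + c₂ a + c₃ a) := X₁_eq a
  have e₁ : (X a).2 ^ 2 - 4 * (X a).1 - 12 = -8 * ((1 - c₁ a) * (1 - c₂ a) * (1 - c₃ a)) := by
    rw [h₁, h₂]; linear_combination 4 * hr
  have n : 0 ≤ (1 - c₁ a) * (1 - c₂ a) * (1 - c₃ a) :=
    mul_nonneg (mul_nonneg (by linarith) (by linarith)) (by linarith)
  refine ⟨by linarith, ?_⟩
  have edge (c : ℝ) (hc : -1 ≤ c) (hc' : c ≤ 1) : 16 * (c - 1) ^ 3 * (c + 1) ≤ 0 := by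
    have : 0 ≤ (1 - c) ^ 3 * (c + 1) := mul_nonneg (pow_nonneg (by linarith) 3) (by linarith)
    nlinarith
  rcases n.eq_or_lt with h | h
  · rcases mul_eq_zero.1 h.symm with h | h
    · rcases mul_eq_zero.1 h with h | h
      · have h3 : c₁ a = 1 := by linarith
        have h4 : c₃ a = c₂ a := by
          rw [h3] at hr; apply sub_eq_zero.1; apply pow_eq_zero_iff two_ne_zero |>.1; linarith
        rw [h₁, h₂, h3, h4]
        convert edge (c₂ a) d₂ b₂ using 1; ring
      · have h3 : c₂ a = 1 := by linarith
        have h4 : c₃ a = c₁ a := by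
          rw [h3] at hr; apply sub_eq_zero.1; apply pow_eq_zero_iff two_ne_zero |>.1; linarith
        rw [h₁, h₂, h3, h4]
        convert edge (c₁ a) d₁ b₁ using 1; ring
    · have h3 : c₃ a = 1 := by linarith
      have h4 : c₂ a = c₁ a := by
        rw [h3] at hr; apply sub_eq_zero.1; apply pow_eq_zero_iff two_ne_zero |>.1; linarith
      rw [h₁, h₂, h3, h4]
      convert edge (c₁ a) d₁ b₁ using 1; ring
  · have hneg : (X a).2 ^ 2 - 4 * (X a).1 - 12 < 0 := by linarith
    rw [K] at hK
    by_contra! hpos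
    nlinarith [sq_nonneg (8 * vdm a), mul_pos (neg_pos.2 hneg) hpos]

/-- The resolvent cubic of a point of `Ω` has three real roots. -/
theorem exists_roots {y : ℝ × ℝ} (hy : y ∈ Ω) : ∃ x₁ x₂ x₃ : ℝ,
    x₁ + x₂ + x₃ = y.2 ∧ x₁ * x₂ + x₁ * x₃ + x₂ * x₃ = y.1 + y.2 ∧
    x₁ * x₂ * x₃ = y.2 ^ 2 - 2 * y.1 - 2 * y.2 - 4 ∧ x₁ ∈ Icc (-2) 2 := by
  rw [mem_Ω_iff] at hy
  obtain ⟨k₁, k₂⟩ := hy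
  obtain ⟨x, hx, hroot⟩ : ∃ x ∈ Icc (-2 : ℝ) 2,
      x ^ 3 - y.2 * x ^ 2 + (y.1 + y.2) * x - (y.2 ^ 2 - 2 * y.1 - 2 * y.2 - 4) = 0 := by
    apply intermediate_value_Icc (by norm_num : (-2 : ℝ) ≤ 2)
      (f := fun x => x ^ 3 - y.2 * x ^ 2 + (y.1 + y.2) * x - (y.2 ^ 2 - 2 * y.1 - 2 * y.2 - 4))
      (by fun_prop)
    -- The cubic takes the value -(y₂ + 2)² at -2 and 12 + 4y₁ - y₂² at 2.
    constructor
    · nlinarith [sq_nonneg (y.2 + 2)]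
    · nlinarith
  obtain ⟨s, hs⟩ : ∃ s, s = y.2 - x := ⟨_, rfl⟩
  obtain ⟨t, ht⟩ : ∃ t, t = y.1 + y.2 - x * s := ⟨_, rfl⟩
  have he₃ : x * t = y.2 ^ 2 - 2 * y.1 - 2 * y.2 - 4 := by
    rw [ht, hs]; linear_combination hroot
  -- After splitting off the root `x`, the discriminant of the cubic is that of the quadratic
  -- cofactor times the square of the cofactor at `x`; the former is `K y ≥ 0`. If the cofactor
  -- vanishes at `x`, its discriminant is visibly a square.
  have hd : 0 ≤ s ^ 2 - 4 * t := by
    by_cases hq : x ^ 2 - s * x + t = 0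
    · have : s ^ 2 - 4 * t = (s - 2 * x) ^ 2 := by linear_combination -4 * hq
      rw [this]; positivity
    · have hdisc : (s ^ 2 - 4 * t) * (x ^ 2 - s * x + t) ^ 2
          = (x + s) ^ 2 * (x * s + t) ^ 2 - 4 * (x * s + t) ^ 3 - 4 * (x + s) ^ 3 * (x * t)
            + 18 * (x + s) * (x * s + t) * (x * t) - 27 * (x * t) ^ 2 := by ring
      rw [he₃, show x + s = y.2 by rw [hs]; ring, show x * s + t = y.1 + y.2 by rw [ht]; ring]
        at hdisc
      have hK := mul_nonneg_of_nonpos_of_nonpos k₁ k₂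
      have hpos : 0 < (x ^ 2 - s * x + t) ^ 2 := by positivity
      refine nonneg_of_mul_nonneg_left ?_ hpos
      rw [hdisc]
      convert hK using 1; ring
  have hsq := sq_sqrt hd
  refine ⟨x, (s + √(s ^ 2 - 4 * t)) / 2, (s - √(s ^ 2 - 4 * t)) / 2, ?_, ?_, ?_, hx⟩
  · rw [hs]; ring
  · linear_combination -1 / 4 * hsq + ht
  · rw [← he₃]; linear_combination - x / 4 * hsq

/-- The roots of the resolvent cubic of a point of `Ω` lie in `[-2, 2]`. -/
theorem root_mem_Icc {y : ℝ × ℝ} (hy : y ∈ Ω) {x₁ x₂ x₃ : ℝ}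
    (h₁ : x₁ + x₂ + x₃ = y.2) (h₂ : x₁ * x₂ + x₁ * x₃ + x₂ * x₃ = y.1 + y.2)
    (h₃ : x₁ * x₂ * x₃ = y.2 ^ 2 - 2 * y.1 - 2 * y.2 - 4) (hx : x₁ ∈ Icc (-2) 2) :
    x₂ ∈ Icc (-2) 2 := by
  rw [mem_Ω_iff] at hy
  obtain ⟨k₁, k₂⟩ := hy
  have hrel : x₁ ^ 2 + x₂ ^ 2 + x₃ ^ 2 - x₁ * x₂ * x₃ = 4 := by
    rw [h₃, ← h₁]; linear_combination -2 * h₂ + 2 * h₁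
  have y₁ : y.1 = x₁ * x₂ + x₁ * x₃ + x₂ * x₃ - (x₁ + x₂ + x₃) := by linarith
  rw [← h₁, y₁] at k₁ k₂
  rw [mem_Icc, ← abs_le] at hx ⊢
  -- Generically (4 - x₁²)(4 - x₂²) = (2x₃ - x₁x₂)² bounds x₂. If x₁ = ±2 this is void, but then x₃
  -- = ±x₂ and the inequalities for `Ω` decide.
  rcases eq_or_ne (x₁ ^ 2) 4 with h | h
  · rcases sq_eq_sq_iff_eq_or_eq_neg.1 (h.trans (by norm_num : (4 : ℝ) = 2 ^ 2)) with rfl | rfl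
    · have h4 : x₃ = x₂ := by
        apply sub_eq_zero.1; apply pow_eq_zero_iff two_ne_zero |>.1; linarith
      rw [h4] at k₂
      have : (x₂ - 2) ^ 3 * (x₂ + 2) ≤ 0 := by linarith
      by_contra! hlt
      rcases lt_abs.1 hlt with h5 | h5
      · have := mul_pos (pow_pos (sub_pos.2 h5) 3) (by linarith : 0 < x₂ + 2)
        linarith
      · have := mul_pos (pow_pos (by linarith : 0 < 2 - x₂) 3) (by linarith : 0 < -x₂ - 2)
        linarith
    · have h4 : x₃ = -x₂ := by
        apply eq_neg_of_add_eq_zero_right; apply pow_eq_zero_iff two_ne_zero |>.1; linarith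
      rw [h4] at k₁
      apply abs_le_of_sq_le_sq _ (by norm_num); linarith
  · have hlt : 0 < 4 - x₁ ^ 2 := by
      have := sq_le_sq' (abs_le.1 hx).1 (abs_le.1 hx).2
      exact lt_of_le_of_ne (by linarith) (by intro h'; apply h; linarith)
    have : 0 ≤ 4 - x₂ ^ 2 := by
      refine nonneg_of_mul_nonneg_right ?_ hlt
      rw [show (4 - x₁ ^ 2) * (4 - x₂ ^ 2) = (2 * x₃ - x₁ * x₂) ^ 2 by linear_combination -4 * hrel]
      positivity
    apply abs_le_of_sq_le_sq _ (by norm_num); linarith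

theorem exists_sorted_roots {y : ℝ × ℝ} (hy : y ∈ Ω) : ∃ x₁ x₂ x₃ : ℝ,
    x₁ + x₂ + x₃ = y.2 ∧ x₁ * x₂ + x₁ * x₃ + x₂ * x₃ = y.1 + y.2 ∧
    x₁ * x₂ * x₃ = y.2 ^ 2 - 2 * y.1 - 2 * y.2 - 4 ∧
    x₁ ≤ 2 ∧ x₂ ≤ x₁ ∧ x₃ ≤ x₂ ∧ -2 ≤ x₃ := by
  obtain ⟨x, u, v, h₁, h₂, h₃, hx⟩ := exists_roots hy
  have hu := root_mem_Icc hy h₁ h₂ h₃ hx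
  have hv : v ∈ Icc (-2 : ℝ) 2 := root_mem_Icc hy (x₁ := x) (x₂ := v) (x₃ := u)
    (by linarith) (by linarith) (by linarith) hx
  obtain ⟨hx, hx'⟩ := hx
  obtain ⟨hu, hu'⟩ := hu
  obtain ⟨hv, hv'⟩ := hv
  rcases le_total u x with a | a <;> rcases le_total v x with b | b <;>
    rcases le_total v u with c | c
  · exact ⟨x, u, v, by linarith, by linarith, by linarith, hx', a, c, hv⟩
  · exact ⟨x, v, u, by linarith, by linarith, by linarith, hx', b, c, hu⟩
  · exact ⟨v, x, u, by linarith, by linarith, by linarith, hv', b, a, hu⟩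
  · exact ⟨v, x, u, by linarith, by linarith, by linarith, hv', b, a, hu⟩
  · exact ⟨u, x, v, by linarith, by linarith, by linarith, hu', a, b, hv⟩
  · exact ⟨u, x, v, by linarith, by linarith, by linarith, hu', a, b, hv⟩
  · exact ⟨u, v, x, by linarith, by linarith, by linarith, hu', c, b, hx⟩
  · exact ⟨v, u, x, by linarith, by linarith, by linarith, hv', c, a, hx⟩

theorem X_image_alcove : X '' alcove = Ω := by
  refine Subset.antisymm (image_subset_iff.2 fun a _ => X_mem_Ω a) fun y hy => ?_
  obtain ⟨x₁, x₂, x₃, h₁, h₂, h₃, b₁, b₂, b₃, b₄⟩ := exists_sorted_roots hy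
  have hrel : x₁ ^ 2 + x₂ ^ 2 + x₃ ^ 2 - x₁ * x₂ * x₃ = 4 := by
    rw [h₃, ← h₁]; linear_combination -2 * h₂ + 2 * h₁
  have hp := pi_pos
  obtain ⟨θ₁, hθ₁⟩ : ∃ θ, θ = arccos (x₁ / 2) := ⟨_, rfl⟩
  obtain ⟨θ₂, hθ₂⟩ : ∃ θ, θ = arccos (x₂ / 2) := ⟨_, rfl⟩
  have m₁ : 0 ≤ θ₁ := hθ₁ ▸ arccos_nonneg _
  have m₂ : θ₂ ≤ π := hθ₂ ▸ arccos_le_pi _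
  have m : θ₁ ≤ θ₂ := by rw [hθ₁, hθ₂]; exact arccos_le_arccos (by linarith)
  have e₁ : cos θ₁ = x₁ / 2 := by rw [hθ₁, cos_arccos] <;> linarith
  have e₂ : cos θ₂ = x₂ / 2 := by rw [hθ₂, cos_arccos] <;> linarith
  have q₁ := sin_sq_add_cos_sq θ₁
  have q₂ := sin_sq_add_cos_sq θ₂
  -- As a quadratic in x₃/2, the relation has the roots cos(θ₁ + θ₂) and cos(θ₂ - θ₁). Since x₃ is
  -- the smallest of the three, the second root can occur only if θ₁ = 0, where both coincide.
  have e₃ : cos (θ₁ + θ₂) = x₃ / 2 := by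
    have hprod : (x₃ / 2 - cos (θ₁ + θ₂)) * (x₃ / 2 - cos (θ₂ - θ₁)) = 0 := by
      rw [cos_add, cos_sub]
      rw [e₁] at q₁ ⊢
      rw [e₂] at q₂ ⊢
      linear_combination hrel / 4 - (sin θ₂) ^ 2 * q₁ - (1 - x₁ ^ 2 / 4) * q₂
    rcases mul_eq_zero.1 hprod with h | h
    · linarith
    · have h' : cos (θ₂ - θ₁) = x₃ / 2 := by linarith
      have hle : θ₂ ≤ θ₂ - θ₁ := by
        by_contra! hlt
        have := cos_lt_cos_of_nonneg_of_le_pi (by linarith) m₂ hlt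
        linarith
      have h0 : θ₁ = 0 := by linarith
      rw [← h', h0]; simp
  have hsum : θ₁ + θ₂ ≤ 2 * π - θ₂ := by
    by_contra! hlt
    have := cos_lt_cos_of_nonneg_of_le_pi (x := 2 * π - (θ₁ + θ₂)) (y := θ₂) (by linarith) m₂
      (by linarith)
    rw [cos_two_pi_sub] at this
    linarith
  refine ⟨((θ₁ + 2 * θ₂) / (2 * π), (θ₁ + θ₂) / (2 * π)), ⟨?_, ?_, ?_⟩, ?_⟩
  · rw [show 2 * ((θ₁ + θ₂) / (2 * π)) - (θ₁ + 2 * θ₂) / (2 * π) = θ₁ / (2 * π) by ring]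
    positivity
  · rw [show 2 * ((θ₁ + 2 * θ₂) / (2 * π)) - 3 * ((θ₁ + θ₂) / (2 * π)) = (θ₂ - θ₁) / (2 * π) by ring]
    exact div_nonneg (by linarith) (by linarith)
  · exact (div_le_one (by linarith)).2 (by linarith)
  · rw [X, X₁_eq, X₂_eq]
    have f₁ : c₁ ((θ₁ + 2 * θ₂) / (2 * π), (θ₁ + θ₂) / (2 * π)) = x₁ / 2 := by
      rw [c₁, ← e₁]; congr 1; field_simp; ring
    have f₂ : c₂ ((θ₁ + 2 * θ₂) / (2 * π), (θ₁ + θ₂) / (2 * π)) = x₂ / 2 := by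
      rw [c₂, ← e₂]; congr 1; field_simp; ring
    have f₃ : c₃ ((θ₁ + 2 * θ₂) / (2 * π), (θ₁ + θ₂) / (2 * π)) = x₃ / 2 := by
      rw [c₃, ← e₃]; congr 1; field_simp
    rw [f₁, f₂, f₃]
    ext
    · linear_combination h₂ - h₁
    · linear_combination h₁

/-! ### The Jacobian of the orbit functions -/

/-- The sine of the angle `2π (2 a₂ - a₁)`. -/
def s₁ (a : ℝ × ℝ) : ℝ := sin (2 * π * (2 * a.2 - a.1))

/-- The sine of the angle `2π (a₁ - a₂)`. -/
def s₂ (a : ℝ × ℝ) : ℝ := sin (2 * π * (a.1 - a.2))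

/-- The sine of the angle `2π a₂`. -/
def s₃ (a : ℝ × ℝ) : ℝ := sin (2 * π * a.2)

/-- The linear form `a ↦ m a₁ + n a₂`. -/
def linForm (m n : ℝ) : ℝ × ℝ →L[ℝ] ℝ :=
  m • ContinuousLinearMap.fst ℝ ℝ ℝ + n • ContinuousLinearMap.snd ℝ ℝ ℝ

theorem hasFDerivAt_cos_linForm (m n : ℝ) (a : ℝ × ℝ) :
    HasFDerivAt (fun a => cos (2 * π * linForm m n a))
      (-sin (2 * π * linForm m n a) • (2 * π) • linForm m n) a :=
  (((linForm m n).hasFDerivAt).const_mul (2 * π)).cos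

theorem hasFDerivAt_c₁ (a : ℝ × ℝ) :
    HasFDerivAt c₁ ((-(2 * π) * s₁ a) • linForm (-1) 2) a := by
  convert hasFDerivAt_cos_linForm (-1) 2 a using 1
  · ext a; simp [c₁, linForm]; congr 2; ring
  · rw [smul_smul, s₁]; congr 1; simp [linForm]; ring_nf

theorem hasFDerivAt_c₂ (a : ℝ × ℝ) :
    HasFDerivAt c₂ ((-(2 * π) * s₂ a) • linForm 1 (-1)) a := by
  convert hasFDerivAt_cos_linForm 1 (-1) a using 1
  · ext a; simp [c₂, linForm]; congr 2
  · rw [smul_smul, s₂]; congr 1; simp [linForm]; ring_nf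

theorem hasFDerivAt_c₃ (a : ℝ × ℝ) :
    HasFDerivAt c₃ ((-(2 * π) * s₃ a) • linForm 0 1) a := by
  convert hasFDerivAt_cos_linForm 0 1 a using 1
  · ext a; simp [c₃, linForm]
  · rw [smul_smul, s₃]; congr 1; simp [linForm]; ring_nf

/-- The differential of `X`. -/
def X' (a : ℝ × ℝ) : ℝ × ℝ →L[ℝ] ℝ × ℝ :=
  LinearMap.toContinuousLinearMap (Matrix.toLin (Module.Basis.finTwoProd ℝ) (Module.Basis.finTwoProd ℝ)
    !![-(2 * π) * (4 * (-s₁ a * (c₂ a + c₃ a) + s₂ a * (c₁ a + c₃ a)) - 2 * (-s₁ a + s₂ a)),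
      -(2 * π) * (4 * (2 * s₁ a * (c₂ a + c₃ a) - s₂ a * (c₁ a + c₃ a) + s₃ a * (c₁ a + c₂ a))
        - 2 * (2 * s₁ a - s₂ a + s₃ a));
      -(2 * π) * (2 * (-s₁ a + s₂ a)), -(2 * π) * (2 * (2 * s₁ a - s₂ a + s₃ a))])

theorem hasFDerivAt_X (a : ℝ × ℝ) : HasFDerivAt X (X' a) a := by
  have h₁ := hasFDerivAt_c₁ a
  have h₂ := hasFDerivAt_c₂ a
  have h₃ := hasFDerivAt_c₃ a
  have hs := (h₁.add h₂).add h₃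
  have e : X = fun a => (4 * (c₁ a * c₂ a + c₁ a * c₃ a + c₂ a * c₃ a)
      - 2 * (c₁ a + c₂ a + c₃ a), 2 * (c₁ a + c₂ a + c₃ a)) := by
    ext a <;> simp [X, X₁_eq, X₂_eq]
  rw [e, X', Matrix.toLin_finTwoProd_toContinuousLinearMap]
  refine (HasFDerivAt.prodMk (((((h₁.mul h₂).add (h₁.mul h₃)).add (h₂.mul h₃)).const_mul 4).sub
    (hs.const_mul 2)) (hs.const_mul 2)).congr_fderiv ?_
  apply ContinuousLinearMap.ext
  intro v
  simp [linForm]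
  constructor <;> ring

/-- The determinant is quadratic in the sines. The squares cancel, and the addition formulas turn
each mixed product into cosines. -/
theorem det_X' (a : ℝ × ℝ) : (X' a).det = (2 * π) ^ 2 * (8 * vdm a) := by
  have t₁ : s₁ a * s₂ a = c₁ a * c₂ a - c₃ a := by
    have h : c₃ a = c₁ a * c₂ a - s₁ a * s₂ a := by
      rw [c₁, c₂, c₃, s₁, s₂, ← cos_add]; congr 1; ring
    linarith
  have t₂ : s₁ a * s₃ a = c₂ a - c₁ a * c₃ a := by
    have h : c₂ a = c₃ a * c₁ a + s₃ a * s₁ a := by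
      rw [c₁, c₂, c₃, s₁, s₃, ← cos_sub]; congr 1; ring
    linarith
  have t₃ : s₂ a * s₃ a = c₁ a - c₂ a * c₃ a := by
    have h : c₁ a = c₃ a * c₂ a + s₃ a * s₂ a := by
      rw [c₁, c₂, c₃, s₂, s₃, ← cos_sub]; congr 1; ring
    linarith
  rw [X', LinearMap.det_toContinuousLinearMap, LinearMap.det_toLin, Matrix.det_fin_two_of, vdm]
  linear_combination -32 * π ^ 2 * ((c₂ a - c₁ a) * t₁ + (c₃ a - c₁ a) * t₂ + (c₂ a - c₃ a) * t₃)

theorem vdm_pos {a : ℝ × ℝ} (h₁ : 0 < 2 * a.2 - a.1) (h₂ : 0 < 2 * a.1 - 3 * a.2)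
    (h₃ : a.1 < 1) : 0 < vdm a := by
  have h := c₁_strictAnti h₁ h₂ h₃
  have h' := c₂_strictAnti h₁ h₂ h₃
  exact mul_pos (mul_pos (by linarith) (by linarith)) (by linarith)

/-! ### Change of variables -/

theorem isClosed_alcove : IsClosed alcove := by
  have h : alcove = {a | 0 ≤ 2 * a.2 - a.1} ∩ ({a | 0 ≤ 2 * a.1 - 3 * a.2} ∩ {a | a.1 ≤ 1}) := by
    ext a; rfl
  rw [h]
  exact (isClosed_le continuous_const (by fun_prop)).inter
    ((isClosed_le continuous_const (by fun_prop)).inter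
      (isClosed_le continuous_fst continuous_const))

theorem volume_line (m n c : ℝ) (h : m ≠ 0 ∨ n ≠ 0) :
    volume {a : ℝ × ℝ | linForm m n a = c} = 0 := by
  have hne : linForm m n ≠ 0 := by
    intro h0
    rcases h with h | h
    · exact h (by simpa [linForm] using DFunLike.congr_fun h0 (1, 0))
    · exact h (by simpa [linForm] using DFunLike.congr_fun h0 (0, 1))
  rcases Set.eq_empty_or_nonempty {a : ℝ × ℝ | linForm m n a = c} with h0 | ⟨x, hx⟩
  · rw [h0, measure_empty]
  · have he : {a : ℝ × ℝ | linForm m n a = c}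
        = (fun a => -x + a) ⁻¹' (LinearMap.ker (linForm m n).toLinearMap : Set (ℝ × ℝ)) := by
      ext a
      have hx' : linForm m n x = c := hx
      simp only [← hx', mem_ofPred_eq, mem_preimage, SetLike.mem_coe, LinearMap.mem_ker, map_add,
        map_neg, ContinuousLinearMap.coe_coe]
      constructor <;> intro h <;> linarith
    rw [he, measure_preimage_add]
    apply Measure.addHaar_submodule
    rw [Ne, LinearMap.ker_eq_top]
    intro h0
    exact hne (ContinuousLinearMap.coe_injective h0)

/-- Off the three walls, which are null sets, the cosines are strictly ordered. -/
theorem ae_vdm_pos : ∀ᵐ a ∂(volume.restrict alcove), 0 < vdm a := by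
  rw [ae_restrict_iff' isClosed_alcove.measurableSet]
  have h₁ := measure_eq_zero_iff_ae_notMem.1 (volume_line (-1) 2 0 (by norm_num))
  have h₂ := measure_eq_zero_iff_ae_notMem.1 (volume_line 2 (-3) 0 (by norm_num))
  have h₃ := measure_eq_zero_iff_ae_notMem.1 (volume_line 1 0 1 (by norm_num))
  filter_upwards [h₁, h₂, h₃] with a n₁ n₂ n₃ ha
  obtain ⟨a₁, a₂, a₃⟩ := ha
  simp only [linForm, add_apply, smul_apply,
    ContinuousLinearMap.coe_fst', ContinuousLinearMap.coe_snd', smul_eq_mul] at n₁ n₂ n₃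
  refine vdm_pos (lt_of_le_of_ne a₁ ?_) (lt_of_le_of_ne a₂ ?_) (lt_of_le_of_ne a₃ ?_)
  · intro h; apply n₁; linarith
  · intro h; apply n₂; linarith
  · intro h; apply n₃; linarith

theorem jacobian_mul_weight {a : ℝ × ℝ} (ha : 0 < vdm a) :
    |(X' a).det| * K (X a) ^ (-(1 / 2) : ℝ) = (2 * π) ^ 2 := by
  have h : 0 < 8 * vdm a := by linarith
  have hrt : ((8 * vdm a) ^ 2) ^ (-(1 / 2) : ℝ) = (8 * vdm a)⁻¹ := by
    rw [← rpow_natCast, ← rpow_mul h.le, show ((2 : ℕ) : ℝ) * (-(1 / 2)) = -1 by norm_num,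
      rpow_neg_one]
  rw [det_X', K_X, abs_of_pos (by positivity), hrt]
  field_simp

theorem ae_jacobian_smul_eq (f : ℝ × ℝ → ℂ) : ∀ᵐ a ∂(volume.restrict alcove),
    |(X' a).det| • (f (X a) * ((K (X a) ^ (-(1 / 2) : ℝ) : ℝ) : ℂ))
      = (((2 * π) ^ 2 : ℝ) : ℂ) * f (X a) := by
  filter_upwards [ae_vdm_pos] with a ha
  rw [← jacobian_mul_weight ha, Complex.real_smul]
  push_cast
  ring

theorem integrableOn_Ω_iff (f : ℝ × ℝ → ℂ) :
    IntegrableOn (fun y => f y * ((K y ^ (-(1 / 2) : ℝ) : ℝ) : ℂ)) Ω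
      ↔ IntegrableOn (fun a => (((2 * π) ^ 2 : ℝ) : ℂ) * f (X a)) alcove := by
  rw [← X_image_alcove, integrableOn_image_iff_integrableOn_abs_det_fderiv_smul volume
    isClosed_alcove.measurableSet (fun a _ => (hasFDerivAt_X a).hasFDerivWithinAt) X_injOn]
  exact integrable_congr (ae_jacobian_smul_eq f)

theorem integral_Ω_eq (f : ℝ × ℝ → ℂ) :
    ∫ y in Ω, f y * ((K y ^ (-(1 / 2) : ℝ) : ℝ) : ℂ)
      = (((2 * π) ^ 2 : ℝ) : ℂ) * ∫ a in alcove, f (X a) := by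
  rw [← X_image_alcove, integral_image_eq_integral_abs_det_fderiv_smul volume
    isClosed_alcove.measurableSet (fun a _ => (hasFDerivAt_X a).hasFDerivWithinAt) X_injOn,
    integral_congr_ae (ae_jacobian_smul_eq f), integral_const_mul]

/-! ### Invariance under the affine Weyl group -/

/-- The point of the coroot lattice with integral coordinates `k`. -/
def latticePoint (k : ℤ × ℤ) : ℝ × ℝ := ((k.1 : ℝ), (k.2 : ℝ))

theorem X_eq_of_cos_eq {a b : ℝ × ℝ} (h₁ : c₁ a = c₁ b) (h₂ : c₂ a = c₂ b) (h₃ : c₃ a = c₃ b) :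
    X a = X b := by
  rw [X, X, X₁_eq, X₂_eq, X₁_eq, X₂_eq, h₁, h₂, h₃]

theorem cos_two_pi_mul_add_intCast (x : ℝ) (n : ℤ) : cos (2 * π * (x + n)) = cos (2 * π * x) := by
  rw [← cos_add_int_mul_two_pi (2 * π * x) n]; congr 1; ring

theorem X_add_latticePoint (a : ℝ × ℝ) (k : ℤ × ℤ) : X (a + latticePoint k) = X a := by
  apply X_eq_of_cos_eq
  · rw [c₁, c₁, ← cos_two_pi_mul_add_intCast (2 * a.2 - a.1) (2 * k.2 - k.1)]
    congr 2; simp [latticePoint]; ring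
  · rw [c₂, c₂, ← cos_two_pi_mul_add_intCast (a.1 - a.2) (k.1 - k.2)]
    congr 2; simp [latticePoint]; ring
  · rw [c₃, c₃, ← cos_two_pi_mul_add_intCast a.2 k.2]
    simp [latticePoint]

theorem X_r₁ (a : ℝ × ℝ) : X (r₁ a) = X a := by
  have h₁ : c₁ (r₁ a) = c₂ a := by rw [c₁, c₂, r₁_apply]; congr 2; ring
  have h₂ : c₂ (r₁ a) = c₁ a := by rw [c₁, c₂, r₁_apply]; congr 2; ring
  have h₃ : c₃ (r₁ a) = c₃ a := by rw [c₃, c₃, r₁_apply]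
  rw [X, X, X₁_eq, X₂_eq, X₁_eq, X₂_eq, h₁, h₂, h₃]
  ext <;> ring

theorem X_r₂ (a : ℝ × ℝ) : X (r₂ a) = X a := by
  have h₁ : c₁ (r₂ a) = c₁ a := by
    rw [c₁, c₁, r₂_apply, ← cos_neg]; congr 1; ring
  have h₂ : c₂ (r₂ a) = c₃ a := by rw [c₂, c₃, r₂_apply]; congr 2; ring
  have h₃ : c₃ (r₂ a) = c₂ a := by rw [c₃, c₂, r₂_apply]
  rw [X, X, X₁_eq, X₂_eq, X₁_eq, X₂_eq, h₁, h₂, h₃]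
  ext <;> ring

theorem weylGroup_induction {motive : ((ℝ × ℝ) ≃ₗ[ℝ] (ℝ × ℝ)) → Prop} (one : motive 1)
    (r₁_mul : ∀ w, motive w → motive (r₁ * w)) (r₂_mul : ∀ w, motive w → motive (r₂ * w))
    {w : (ℝ × ℝ) ≃ₗ[ℝ] (ℝ × ℝ)} (hw : w ∈ weylGroup) : motive w := by
  have e₁ : r₁⁻¹ = r₁ := inv_eq_of_mul_eq_one_left (by
    ext a <;> simp [LinearEquiv.mul_apply, r₁_apply])
  have e₂ : r₂⁻¹ = r₂ := inv_eq_of_mul_eq_one_left (by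
    ext a <;> simp [LinearEquiv.mul_apply, r₂_apply])
  refine Subgroup.closure_induction_left (p := fun w _ => motive w) one ?_ ?_ hw
  · rintro x (rfl | rfl) w - h
    exacts [r₁_mul w h, r₂_mul w h]
  · rintro x (rfl | rfl) w - h
    · rw [e₁]; exact r₁_mul w h
    · rw [e₂]; exact r₂_mul w h

theorem X_weylGroup {w : (ℝ × ℝ) ≃ₗ[ℝ] (ℝ × ℝ)} (hw : w ∈ weylGroup) (a : ℝ × ℝ) :
    X (w a) = X a := by
  refine weylGroup_induction (motive := fun w => X (w a) = X a) rfl ?_ ?_ hw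
  · intro w h; rw [LinearEquiv.mul_apply, X_r₁, h]
  · intro w h; rw [LinearEquiv.mul_apply, X_r₂, h]

theorem weylGroup_latticePoint {w : (ℝ × ℝ) ≃ₗ[ℝ] (ℝ × ℝ)} (hw : w ∈ weylGroup) (k : ℤ × ℤ) :
    ∃ k', w (latticePoint k) = latticePoint k' := by
  refine weylGroup_induction (motive := fun w => ∃ k', w (latticePoint k) = latticePoint k')
    ⟨k, rfl⟩ ?_ ?_ hw
  · rintro w ⟨k', h⟩
    refine ⟨(-k'.1 + 3 * k'.2, k'.2), ?_⟩
    rw [LinearEquiv.mul_apply, h, r₁_apply]; simp [latticePoint]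
  · rintro w ⟨k', h⟩
    refine ⟨(k'.1, k'.1 - k'.2), ?_⟩
    rw [LinearEquiv.mul_apply, h, r₂_apply]; simp [latticePoint]

theorem measurePreserving_weylGroup {w : (ℝ × ℝ) ≃ₗ[ℝ] (ℝ × ℝ)} (hw : w ∈ weylGroup) :
    MeasurePreserving w (volume : Measure (ℝ × ℝ)) volume := by
  have invol {r : (ℝ × ℝ) ≃ₗ[ℝ] (ℝ × ℝ)} (hr : ∀ a, r (r a) = a) :
      MeasurePreserving r (volume : Measure (ℝ × ℝ)) volume := by
    have hdet : LinearMap.det (r : ℝ × ℝ →ₗ[ℝ] ℝ × ℝ) * LinearMap.det (r : ℝ × ℝ →ₗ[ℝ] ℝ × ℝ)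
        = 1 := by
      rw [← LinearMap.det_comp, show (r : ℝ × ℝ →ₗ[ℝ] ℝ × ℝ) ∘ₗ r = LinearMap.id from
        LinearMap.ext hr, LinearMap.det_id]
    refine ⟨(LinearMap.continuous_of_finiteDimensional (r : ℝ × ℝ →ₗ[ℝ] ℝ × ℝ)).measurable, ?_⟩
    have h := Measure.map_linearMap_addHaar_eq_smul_addHaar (volume : Measure (ℝ × ℝ))
      (f := (r : ℝ × ℝ →ₗ[ℝ] ℝ × ℝ)) (left_ne_zero_of_mul_eq_one hdet)
    rw [abs_inv, show |LinearMap.det (r : ℝ × ℝ →ₗ[ℝ] ℝ × ℝ)| = 1 by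
      rcases mul_self_eq_one_iff.1 hdet with h | h <;> rw [h] <;> simp] at h
    simpa using h
  refine weylGroup_induction (motive := fun w => MeasurePreserving w _ _)
    (MeasurePreserving.id _) ?_ ?_ hw
  · intro w h
    exact (invol (r := r₁) (by intro a; ext <;> simp [r₁_apply])).comp h
  · intro w h
    exact (invol (r := r₂) (by intro a; ext <;> simp [r₂_apply])).comp h

/-! ### The images of the alcove cover the plane -/

/-- The twelve elements of the Weyl group. -/
def weylElt (i : ℕ) (j : ℕ) : (ℝ × ℝ) ≃ₗ[ℝ] (ℝ × ℝ) := (r₁ * r₂) ^ i * r₁ ^ j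

theorem weylElt_mem (i j : ℕ) : weylElt i j ∈ weylGroup := by
  have h₁ : r₁ ∈ weylGroup := Subgroup.subset_closure (by simp)
  have h₂ : r₂ ∈ weylGroup := Subgroup.subset_closure (by simp)
  exact mul_mem (pow_mem (mul_mem h₁ h₂) i) (pow_mem h₁ j)

/-- The point at which the angles of `c₁` and `c₂` are `2π p` and `2π q`. -/
def ofAngles (p q : ℝ) : ℝ × ℝ := (p + 2 * q, p + q)

/-- On triples (p, q, -(p + q)) of sum zero, `r₁ * r₂` is a cyclic permutation combined with a
change of all signs. -/
theorem weylElt_succ_ofAngles {i j : ℕ} {a : ℝ × ℝ} {p q : ℝ} (h : weylElt i j a = ofAngles p q) :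
    weylElt (i + 1) j a = ofAngles (p + q) (-p) := by
  have h' : weylElt (i + 1) j a = r₁ (r₂ (weylElt i j a)) := by
    rw [weylElt, pow_succ', mul_assoc]; rfl
  rw [h', h, r₂_apply, r₁_apply]; ext <;> simp [ofAngles] <;> ring

theorem exists_mem_alcove_of_angles {i j : ℕ} {a : ℝ × ℝ} {u v : ℝ} (m n : ℤ) (hi : i < 6)
    (hj : j < 2) (h : weylElt i j a = ofAngles u v) (h₁ : 0 ≤ u - m) (h₂ : u - m ≤ v - n)
    (h₃ : (u - m) + 2 * (v - n) ≤ 1) :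
    ∃ i < 6, ∃ j < 2, ∃ k, weylElt i j a + latticePoint k ∈ alcove := by
  refine ⟨i, hi, j, hj, (-m - 2 * n, -m - n), ?_⟩
  rw [h]
  refine ⟨?_, ?_, ?_⟩ <;> simp [ofAngles, latticePoint] <;> linarith

/-- The group permutes the triple p, q, -(p + q) and changes all signs; the lattice shifts the
entries by integers of sum zero. The fractional parts sum to 0, 1 or 2. When the sum is 1, sorting
them suffices, because u + 2v ≤ 1 says that v is at most the third part. -/
theorem exists_mem_alcove (a : ℝ × ℝ) :
    ∃ i < 6, ∃ j < 2, ∃ k, weylElt i j a + latticePoint k ∈ alcove := by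
  obtain ⟨p, q, rfl⟩ : ∃ p q, a = ofAngles p q :=
    ⟨2 * a.2 - a.1, a.1 - a.2, by ext <;> simp [ofAngles] <;> ring⟩
  have p₀ := Int.floor_le p
  have p₁ := Int.lt_floor_add_one p
  have q₀ := Int.floor_le q
  have q₁ := Int.lt_floor_add_one q
  have r₀ := Int.floor_le (-(p + q))
  have r₁' := Int.lt_floor_add_one (-(p + q))
  generalize ⌊p⌋ = l at *
  generalize ⌊q⌋ = m at *
  generalize ⌊-(p + q)⌋ = n at *
  have t₁ : -3 < l + m + n := by
    have : (-3 : ℝ) < ((l + m + n : ℤ) : ℝ) := by push_cast; linarith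
    exact_mod_cast this
  have t₂ : l + m + n ≤ 0 := by
    have : ((l + m + n : ℤ) : ℝ) ≤ 0 := by push_cast; linarith
    exact_mod_cast this
  have ht : l + m + n = 0 ∨ l + m + n = -1 ∨ l + m + n = -2 := by omega
  have w00 : weylElt 0 0 (ofAngles p q) = ofAngles (p) (q) := by
    simp [weylElt]
  have w10 : weylElt 1 0 (ofAngles p q) = ofAngles (p + q) (-p) := by
    convert weylElt_succ_ofAngles w00 using 2
  have w20 : weylElt 2 0 (ofAngles p q) = ofAngles (q) (-(p + q)) := by
    convert weylElt_succ_ofAngles w10 using 2; ring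
  have w30 : weylElt 3 0 (ofAngles p q) = ofAngles (-p) (-q) := by
    convert weylElt_succ_ofAngles w20 using 2; ring
  have w40 : weylElt 4 0 (ofAngles p q) = ofAngles (-(p + q)) (p) := by
    convert weylElt_succ_ofAngles w30 using 2 <;> ring
  have w50 : weylElt 5 0 (ofAngles p q) = ofAngles (-q) (p + q) := by
    convert weylElt_succ_ofAngles w40 using 2 <;> ring
  have w01 : weylElt 0 1 (ofAngles p q) = ofAngles (q) (p) := by
    rw [weylElt, pow_zero, one_mul, pow_one, r₁_apply]; ext <;> simp [ofAngles] <;> ring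
  have w11 : weylElt 1 1 (ofAngles p q) = ofAngles (p + q) (-q) := by
    convert weylElt_succ_ofAngles w01 using 2; ring
  have w21 : weylElt 2 1 (ofAngles p q) = ofAngles (p) (-(p + q)) := by
    convert weylElt_succ_ofAngles w11 using 2; ring
  have w31 : weylElt 3 1 (ofAngles p q) = ofAngles (-q) (-p) := by
    convert weylElt_succ_ofAngles w21 using 2; ring
  have w41 : weylElt 4 1 (ofAngles p q) = ofAngles (-(p + q)) (q) := by
    convert weylElt_succ_ofAngles w31 using 2 <;> ring
  have w51 : weylElt 5 1 (ofAngles p q) = ofAngles (-p) (p + q) := by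
    convert weylElt_succ_ofAngles w41 using 2 <;> ring
  rcases ht with h | h | h
  · have h' : (l : ℝ) + m + n = 0 := by exact_mod_cast h
    refine exists_mem_alcove_of_angles l m (by norm_num) (by norm_num) w00 ?_ ?_ ?_ <;> linarith
  · have h' : (l : ℝ) + m + n = -1 := by exact_mod_cast h
    rcases le_total (p - l) (q - m) with a | a <;> rcases le_total (q - m) (-(p + q) - n) with b | b <;>
      rcases le_total (p - l) (-(p + q) - n) with c | c
    · refine exists_mem_alcove_of_angles l m (by norm_num) (by norm_num) w00 ?_ ?_ ?_ <;>
        linarith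
    · refine exists_mem_alcove_of_angles l m (by norm_num) (by norm_num) w00 ?_ ?_ ?_ <;>
        linarith
    · refine exists_mem_alcove_of_angles l n (by norm_num) (by norm_num) w21 ?_ ?_ ?_ <;>
        linarith
    · refine exists_mem_alcove_of_angles n l (by norm_num) (by norm_num) w40 ?_ ?_ ?_ <;>
        linarith
    · refine exists_mem_alcove_of_angles m l (by norm_num) (by norm_num) w01 ?_ ?_ ?_ <;>
        linarith
    · refine exists_mem_alcove_of_angles m n (by norm_num) (by norm_num) w20 ?_ ?_ ?_ <;>
        linarith
    · refine exists_mem_alcove_of_angles n m (by norm_num) (by norm_num) w41 ?_ ?_ ?_ <;>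
        linarith
    · refine exists_mem_alcove_of_angles n m (by norm_num) (by norm_num) w41 ?_ ?_ ?_ <;>
        linarith
  -- Negation turns each fractional part f into 1 - f, hence the shifts of the form `-n - 1`, and
  -- brings the sum from 2 back to 1.
  · have h' : (l : ℝ) + m + n = -2 := by exact_mod_cast h
    rcases le_total (p - l) (q - m) with a | a <;> rcases le_total (q - m) (-(p + q) - n) with b | b <;>
      rcases le_total (p - l) (-(p + q) - n) with c | c
    · refine exists_mem_alcove_of_angles (-n - 1) (-m - 1) (by norm_num) (by norm_num) w11 ?_ ?_ ?_ <;>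
        push_cast <;> linarith
    · refine exists_mem_alcove_of_angles (-n - 1) (-m - 1) (by norm_num) (by norm_num) w11 ?_ ?_ ?_ <;>
        push_cast <;> linarith
    · refine exists_mem_alcove_of_angles (-m - 1) (-n - 1) (by norm_num) (by norm_num) w50 ?_ ?_ ?_ <;>
        push_cast <;> linarith
    · refine exists_mem_alcove_of_angles (-m - 1) (-l - 1) (by norm_num) (by norm_num) w31 ?_ ?_ ?_ <;>
        push_cast <;> linarith
    · refine exists_mem_alcove_of_angles (-n - 1) (-l - 1) (by norm_num) (by norm_num) w10 ?_ ?_ ?_ <;>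
        push_cast <;> linarith
    · refine exists_mem_alcove_of_angles (-l - 1) (-n - 1) (by norm_num) (by norm_num) w51 ?_ ?_ ?_ <;>
        push_cast <;> linarith
    · refine exists_mem_alcove_of_angles (-l - 1) (-m - 1) (by norm_num) (by norm_num) w30 ?_ ?_ ?_ <;>
        push_cast <;> linarith
    · refine exists_mem_alcove_of_angles (-l - 1) (-m - 1) (by norm_num) (by norm_num) w30 ?_ ?_ ?_ <;>
        push_cast <;> linarith

/-! ### Folding the unit square onto the alcove -/

/-- A half-open unit square, a fundamental domain of the coroot lattice. -/
def unitSquare : Set (ℝ × ℝ) := Ico 0 1 ×ˢ Ico 0 1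

theorem unitSquare_eq : unitSquare = ZSpan.fundamentalDomain (Module.Basis.finTwoProd ℝ) := by
  ext a
  simp [unitSquare, Fin.forall_fin_two, and_assoc]

theorem volume_unitSquare : volume unitSquare = 1 := by
  rw [unitSquare, Measure.volume_eq_prod, Measure.prod_prod]; simp

theorem mem_span_iff_exists_latticePoint (x : ℝ × ℝ) :
    x ∈ Submodule.span ℤ (range (Module.Basis.finTwoProd ℝ)) ↔ ∃ k, latticePoint k = x := by
  rw [Module.Basis.mem_span_iff_repr_mem]
  simp only [Fin.forall_fin_two, mem_range, Prod.exists, latticePoint]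
  constructor
  · rintro ⟨⟨m, hm⟩, n, hn⟩
    refine ⟨m, n, ?_⟩
    ext
    · simpa using hm
    · simpa using hn
  · rintro ⟨m, n, rfl⟩
    exact ⟨⟨m, by simp⟩, n, by simp⟩

/-- By `exists_mem_alcove` the lattice translates of twelve Weyl images of the alcove cover the
plane, so `g` is at most the sum of its restrictions to them. For each Weyl element, unfolding over
the lattice gives one integral over the alcove. -/
theorem lintegral_unitSquare_le {g : ℝ × ℝ → ℝ≥0∞} (hg : Measurable g)
    (hW : ∀ w ∈ weylGroup, ∀ a, g (w a) = g a) (hL : ∀ a k, g (a + latticePoint k) = g a) :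
    ∫⁻ a in unitSquare, g a ≤ 12 * ∫⁻ a in alcove, g a := by
  let L := Submodule.span ℤ (range (Module.Basis.finTwoProd ℝ))
  have hmeas (i j : ℕ) : MeasurableSet (weylElt i j ⁻¹' alcove) :=
    (measurePreserving_weylGroup (weylElt_mem i j)).measurable isClosed_alcove.measurableSet
  have : VAddInvariantMeasure L (ℝ × ℝ) volume :=
    ⟨fun l s _ => measure_preimage_add volume (l : ℝ × ℝ) s⟩
  have key (i j : ℕ) : ∑' l : L, ∫⁻ a in unitSquare, (weylElt i j ⁻¹' alcove).indicator g (l +ᵥ a)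
      = ∫⁻ a in alcove, g a := by
    rw [unitSquare_eq, ← (ZSpan.isAddFundamentalDomain (Module.Basis.finTwoProd ℝ)
      volume).lintegral_eq_tsum'', lintegral_indicator (hmeas i j),
      ← (measurePreserving_weylGroup (weylElt_mem i j)).setLIntegral_comp_preimage
        isClosed_alcove.measurableSet hg]
    simp_rw [hW _ (weylElt_mem i j)]
  have hle (a : ℝ × ℝ) : g a ≤ ∑ i ∈ Finset.range 6, ∑ j ∈ Finset.range 2,
      ∑' l : L, (weylElt i j ⁻¹' alcove).indicator g (l +ᵥ a) := by
    obtain ⟨i, hi, j, hj, k, hk⟩ := exists_mem_alcove a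
    obtain ⟨k', hk'⟩ := weylGroup_latticePoint (inv_mem (weylElt_mem i j)) k
    have hk'' : weylElt i j (latticePoint k') = latticePoint k := by
      rw [← hk', ← LinearEquiv.mul_apply, mul_inv_cancel]; rfl
    let l : L := ⟨latticePoint k', (mem_span_iff_exists_latticePoint _).2 ⟨k', rfl⟩⟩
    have hl : l +ᵥ a = a + latticePoint k' := add_comm _ _
    calc g a = (weylElt i j ⁻¹' alcove).indicator g (l +ᵥ a) := by
          rw [indicator_of_mem, hl, hL]
          rw [hl, mem_preimage, map_add, hk'']
          exact hk
      _ ≤ ∑' l : L, (weylElt i j ⁻¹' alcove).indicator g (l +ᵥ a) := ENNReal.le_tsum l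
      _ ≤ ∑ j ∈ Finset.range 2, ∑' l : L, (weylElt i j ⁻¹' alcove).indicator g (l +ᵥ a) :=
          Finset.single_le_sum (f := fun j => ∑' l : L,
            (weylElt i j ⁻¹' alcove).indicator g (l +ᵥ a)) (fun _ _ => zero_le)
            (Finset.mem_range.2 hj)
      _ ≤ _ := Finset.single_le_sum (f := fun i => ∑ j ∈ Finset.range 2, ∑' l : L,
            (weylElt i j ⁻¹' alcove).indicator g (l +ᵥ a)) (fun _ _ => zero_le)
            (Finset.mem_range.2 hi)
  have hm (i j : ℕ) (l : L) :
      Measurable fun a : ℝ × ℝ => (weylElt i j ⁻¹' alcove).indicator g (l +ᵥ a) :=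
    (hg.indicator (hmeas i j)).comp (measurable_const_vadd l)
  calc ∫⁻ a in unitSquare, g a
      ≤ ∫⁻ a in unitSquare, ∑ i ∈ Finset.range 6, ∑ j ∈ Finset.range 2,
          ∑' l : L, (weylElt i j ⁻¹' alcove).indicator g (l +ᵥ a) := lintegral_mono hle
    _ = ∑ i ∈ Finset.range 6, ∑ j ∈ Finset.range 2, ∫⁻ a in alcove, g a := by
        rw [lintegral_finsetSum _ fun i _ => Finset.measurable_sum _ fun j _ =>
          Measurable.tsum (hm i j)]
        refine Finset.sum_congr rfl fun i _ => ?_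
        rw [lintegral_finsetSum _ fun j _ => Measurable.tsum (hm i j)]
        refine Finset.sum_congr rfl fun j _ => ?_
        rw [lintegral_tsum fun l => (hm i j l).aemeasurable, key]
    _ = 12 * ∫⁻ a in alcove, g a := by
        simp only [Finset.sum_const, Finset.card_range, nsmul_eq_mul, ← mul_assoc]; norm_num

theorem volume_alcove_le : volume alcove ≤ ENNReal.ofReal (1 / 12) := by
  rw [Measure.volume_eq_prod, Measure.prod_apply isClosed_alcove.measurableSet]
  have hle (x : ℝ) : volume (Prod.mk x ⁻¹' alcove)
      ≤ (Icc 0 1).indicator (fun x => ENNReal.ofReal (x / 6)) x := by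
    have hsub : Prod.mk x ⁻¹' alcove ⊆ Icc (x / 2) (2 * x / 3) := by
      rintro t ⟨h₁, h₂, -⟩
      simp only at h₁ h₂
      exact ⟨by linarith, by linarith⟩
    by_cases hx : x ∈ Icc (0 : ℝ) 1
    · rw [indicator_of_mem hx]
      refine (measure_mono hsub).trans_eq ?_
      rw [volume_Icc]; congr 1; ring
    · have : Prod.mk x ⁻¹' alcove = ∅ := by
        refine eq_empty_of_forall_notMem fun t ht => hx ?_
        obtain ⟨h₁, h₂, h₃⟩ := ht
        simp only at h₁ h₂ h₃
        exact ⟨by linarith, by linarith⟩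
      rw [this, measure_empty]; exact zero_le
  refine (lintegral_mono hle).trans_eq ?_
  rw [lintegral_indicator measurableSet_Icc, ← ofReal_integral_eq_lintegral_ofReal]
  · congr 1
    rw [integral_Icc_eq_integral_Ioc, ← intervalIntegral.integral_of_le zero_le_one]
    simp [intervalIntegral.integral_div]; norm_num
  · exact (by fun_prop : Continuous fun x : ℝ => x / 6).integrableOn_Icc
  · filter_upwards [ae_restrict_mem measurableSet_Icc] with x hx
    exact div_nonneg hx.1 (by norm_num)

theorem volume_alcove_ne_top : volume alcove ≠ ∞ :=
  ne_top_of_le_ne_top ENNReal.ofReal_ne_top volume_alcove_le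

theorem integrableOn_of_bound {E : Type*} [NormedAddCommGroup E] {h : ℝ × ℝ → E}
    [SecondCountableTopology E] (hc : Continuous h) {C : ℝ}
    (hC : ∀ a, ‖h a‖ ≤ C) {s : Set (ℝ × ℝ)} (hs : volume s ≠ ∞) : IntegrableOn h s :=
  Measure.integrableOn_of_bounded hs hc.aestronglyMeasurable (Filter.Eventually.of_forall hC)

theorem integral_unitSquare_le {h : ℝ × ℝ → ℝ} (hc : Continuous h) {C : ℝ} (hC : ∀ a, ‖h a‖ ≤ C)
    (h0 : ∀ a, 0 ≤ h a)
    (hW : ∀ w ∈ weylGroup, ∀ a, h (w a) = h a) (hL : ∀ a k, h (a + latticePoint k) = h a) :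
    ∫ a in unitSquare, h a ≤ 12 * ∫ a in alcove, h a := by
  have i₁ := integrableOn_of_bound hc hC (s := unitSquare) (by simp [volume_unitSquare])
  have i₂ := integrableOn_of_bound hc hC volume_alcove_ne_top
  have := lintegral_unitSquare_le (g := fun a => ENNReal.ofReal (h a)) hc.measurable.ennreal_ofReal
    (fun w hw a => by rw [hW w hw]) (fun a k => by rw [hL])
  rw [← ofReal_integral_eq_lintegral_ofReal i₁ (Filter.Eventually.of_forall h0),
    ← ofReal_integral_eq_lintegral_ofReal i₂ (Filter.Eventually.of_forall h0),
    show (12 : ℝ≥0∞) = ENNReal.ofReal 12 by simp, ← ENNReal.ofReal_mul (by norm_num)] at this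
  exact (ENNReal.ofReal_le_ofReal_iff (mul_nonneg (by norm_num)
    (integral_nonneg h0))).1 this

/-- Disjointness of the images is never needed: the covering inequality is applied to h + C ≥ 0, and
the constants drop out because the alcove has area at most 1/12. Using it for both h and -h gives
equality. -/
theorem integral_unitSquare_eq {h : ℝ × ℝ → ℝ} (hc : Continuous h) {C : ℝ} (hC : ∀ a, ‖h a‖ ≤ C)
    (hW : ∀ w ∈ weylGroup, ∀ a, h (w a) = h a) (hL : ∀ a k, h (a + latticePoint k) = h a) :
    ∫ a in unitSquare, h a = 12 * ∫ a in alcove, h a := by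
  have upper {h : ℝ × ℝ → ℝ} (hc : Continuous h) (hC : ∀ a, ‖h a‖ ≤ C)
      (hW : ∀ w ∈ weylGroup, ∀ a, h (w a) = h a) (hL : ∀ a k, h (a + latticePoint k) = h a) :
      ∫ a in unitSquare, h a ≤ 12 * ∫ a in alcove, h a := by
    have i₁ := integrableOn_of_bound hc hC (s := unitSquare) (by simp [volume_unitSquare])
    have i₂ := integrableOn_of_bound hc hC volume_alcove_ne_top
    have hC' (a : ℝ × ℝ) : -C ≤ h a ∧ h a ≤ C := abs_le.1 (hC a)
    have hC0 : 0 ≤ C := (norm_nonneg _).trans (hC 0)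
    have := integral_unitSquare_le (h := fun a => h a + C) (C := 2 * C) (by fun_prop)
      (fun a => by
        rw [norm_eq_abs, abs_le]; constructor <;> linarith [(hC' a).1, (hC' a).2])
      (fun a => by linarith [(hC' a).1]) (fun w hw a => by rw [hW w hw]) (fun a k => by rw [hL])
    rw [integral_add i₁ (integrableOn_const (by simp [volume_unitSquare])),
      integral_add i₂ (integrableOn_const volume_alcove_ne_top), setIntegral_const,
      setIntegral_const, measureReal_def, volume_unitSquare] at this
    have hv : volume.real alcove ≤ 1 / 12 :=
      ENNReal.toReal_le_of_le_ofReal (by norm_num) volume_alcove_le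
    have := mul_le_mul_of_nonneg_right hv hC0
    simp only [ENNReal.toReal_one, smul_eq_mul] at *
    linarith
  refine le_antisymm (upper hc hC hW hL) ?_
  have := upper (h := fun a => -h a) hc.neg (by simpa using hC) (fun w hw a => by rw [hW w hw])
    (fun a k => by rw [hL])
  rw [integral_neg, integral_neg] at this
  linarith

/-! ### Trigonometric polynomials -/

/-- The character of the torus with weight `m ω₁ + n ω₂`. -/
def character (m n : ℤ) (a : ℝ × ℝ) : ℂ :=
  Complex.exp (2 * π * Complex.I * (m * a.1)) * Complex.exp (2 * π * Complex.I * (n * a.2))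

theorem character_mul (m n m' n' : ℤ) :
    character m n * character m' n' = character (m + m') (n + n') := by
  ext a
  simp only [character, Pi.mul_apply, ← Complex.exp_add]
  congr 1; push_cast; ring

theorem continuous_character (m n : ℤ) : Continuous (character m n) := by
  unfold character; fun_prop

theorem norm_character (m n : ℤ) (a : ℝ × ℝ) : ‖character m n a‖ = 1 := by
  have h (k : ℤ) (x : ℝ) : ‖Complex.exp (2 * π * Complex.I * (k * x))‖ = 1 := by
    rw [← Complex.norm_exp_ofReal_mul_I (2 * π * (k * x))]; congr 2; push_cast; ring
  rw [character, norm_mul, h, h, mul_one]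

/-- The weight `m ω₁ + n ω₂` lies in the dual ball of radius `N` with respect to the long
coroots. -/
def WeightLE (N : ℕ) (m n : ℤ) : Prop := |n| ≤ N ∧ |3 * m + n| ≤ N ∧ |3 * m + 2 * n| ≤ N

/-- The trigonometric polynomials of degree at most `N`. -/
def trigPoly (N : ℕ) : Submodule ℂ (ℝ × ℝ → ℂ) :=
  Submodule.span ℂ {f | ∃ m n, WeightLE N m n ∧ f = character m n}

theorem character_mem {N : ℕ} {m n : ℤ} (h : WeightLE N m n) : character m n ∈ trigPoly N :=
  Submodule.subset_span ⟨m, n, h, rfl⟩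

theorem trigPoly_mono {N N' : ℕ} (h : N ≤ N') : trigPoly N ≤ trigPoly N' := by
  apply Submodule.span_mono
  rintro f ⟨m, n, ⟨h₁, h₂, h₃⟩, rfl⟩
  have h' : (N : ℤ) ≤ N' := by exact_mod_cast h
  exact ⟨m, n, ⟨h₁.trans h', h₂.trans h', h₃.trans h'⟩, rfl⟩

theorem mul_mem_trigPoly {N N' : ℕ} {f g : ℝ × ℝ → ℂ} (hf : f ∈ trigPoly N)
    (hg : g ∈ trigPoly N') : f * g ∈ trigPoly (N + N') := by
  induction hf using Submodule.span_induction with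
  | mem f hf =>
    obtain ⟨m, n, ⟨h₁, h₂, h₃⟩, rfl⟩ := hf
    induction hg using Submodule.span_induction with
    | mem g hg =>
      obtain ⟨m', n', ⟨h₁', h₂', h₃'⟩, rfl⟩ := hg
      rw [character_mul]
      rw [abs_le] at *
      refine character_mem ⟨?_, ?_, ?_⟩ <;> rw [abs_le] <;> push_cast <;> constructor <;> linarith
    | zero => rw [mul_zero]; exact zero_mem _
    | add g g' _ _ hg hg' => rw [mul_add]; exact add_mem hg hg'
    | smul c g _ hg => rw [mul_smul_comm]; exact Submodule.smul_mem _ c hg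
  | zero => rw [zero_mul]; exact zero_mem _
  | add f f' _ _ hf hf' => rw [add_mul]; exact add_mem hf hf'
  | smul c f _ hf => rw [smul_mul_assoc]; exact Submodule.smul_mem _ c hf

theorem pow_mem_trigPoly {N : ℕ} {f : ℝ × ℝ → ℂ} (hf : f ∈ trigPoly N) (k : ℕ) :
    f ^ k ∈ trigPoly (N * k) := by
  induction k with
  | zero =>
    rw [pow_zero, show (1 : ℝ × ℝ → ℂ) = character 0 0 by ext a; simp [character]]
    exact character_mem (by simp [WeightLE])
  | succ k ih => rw [pow_succ, mul_add_one]; exact mul_mem_trigPoly ih hf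

theorem two_cos_mem_trigPoly {N : ℕ} {m n : ℤ} (h : WeightLE N m n) :
    (fun a : ℝ × ℝ => ((2 * cos (2 * π * (m * a.1 + n * a.2)) : ℝ) : ℂ)) ∈ trigPoly N := by
  have hneg : WeightLE N (-m) (-n) := by
    obtain ⟨h₁, h₂, h₃⟩ := h
    refine ⟨by rwa [abs_neg], ?_, ?_⟩
    · rwa [← abs_neg, show -(3 * -m + -n) = 3 * m + n by ring]
    · rwa [← abs_neg, show -(3 * -m + 2 * -n) = 3 * m + 2 * n by ring]
  convert add_mem (character_mem h) (character_mem hneg) using 1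
  ext a
  simp only [character, Pi.add_apply, ← Complex.exp_add]
  push_cast
  rw [Complex.two_cos]
  congr 2 <;> ring

/-- The degrees 3 here and 2 for `X₂` are the weights in `mDegree`, which is why composition with
`X` respects degrees. -/
theorem X₁_mem_trigPoly : (fun a => (X₁ a : ℂ)) ∈ trigPoly 3 := by
  have h₁ := two_cos_mem_trigPoly (N := 3) (m := 1) (n := 0) (by simp [WeightLE])
  have h₂ := two_cos_mem_trigPoly (N := 3) (m := 1) (n := -3) (by simp [WeightLE])
  have h₃ := two_cos_mem_trigPoly (N := 3) (m := 2) (n := -3) (by simp [WeightLE])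
  convert add_mem (add_mem h₁ h₂) h₃ using 1
  ext a
  simp only [Pi.add_apply, X₁]
  norm_cast
  push_cast
  rw [mul_add, mul_add]
  congr 6 <;> ring

theorem X₂_mem_trigPoly : (fun a => (X₂ a : ℂ)) ∈ trigPoly 2 := by
  have h₁ := two_cos_mem_trigPoly (N := 2) (m := 0) (n := 1) (by simp [WeightLE])
  have h₂ := two_cos_mem_trigPoly (N := 2) (m := 1) (n := -1) (by simp [WeightLE])
  have h₃ := two_cos_mem_trigPoly (N := 2) (m := 1) (n := -2) (by simp [WeightLE])
  convert add_mem (add_mem h₁ h₂) h₃ using 1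
  ext a
  simp only [Pi.add_apply, X₂]
  norm_cast
  push_cast
  rw [mul_add, mul_add]
  congr 6 <;> ring

/-! ### The cubature rule on the torus -/

/-- The mean of `f` over the uniform grid in the unit square. -/
def gridMean (M : ℕ) (f : ℝ × ℝ → ℂ) : ℂ :=
  1 / (M : ℂ) ^ 2 * ∑ k ∈ Finset.range M ×ˢ Finset.range M, f (k.1 / M, k.2 / M)

theorem integral_exp_Ico (m : ℤ) :
    ∫ x in Ico (0 : ℝ) 1, Complex.exp (2 * π * Complex.I * (m * x)) = if m = 0 then 1 else 0 := by
  rw [integral_Ico_eq_integral_Ioc, ← intervalIntegral.integral_of_le zero_le_one]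
  split_ifs with h
  · simp [h]
  · have hm : (2 * π * Complex.I * m : ℂ) ≠ 0 := by
      simp [h, pi_ne_zero]
    simp_rw [← mul_assoc]
    rw [integral_exp_mul_complex hm]
    have : Complex.exp (2 * π * Complex.I * m) = 1 := by
      rw [Complex.exp_eq_one_iff]; exact ⟨m, by ring⟩
    simp [this]

theorem sum_exp_range {M : ℕ} (hM : 0 < M) (m : ℤ) :
    ∑ k ∈ Finset.range M, Complex.exp (2 * π * Complex.I * (m * ((k / M : ℝ) : ℂ)))
      = if (M : ℤ) ∣ m then (M : ℂ) else 0 := by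
  have hM' : (M : ℂ) ≠ 0 := by exact_mod_cast hM.ne'
  have hpow (k : ℕ) : Complex.exp (2 * π * Complex.I * (m * ((k / M : ℝ) : ℂ)))
      = Complex.exp (2 * π * Complex.I * (m / M)) ^ k := by
    rw [← Complex.exp_nat_mul]; congr 1; push_cast; ring
  have hone : Complex.exp (2 * π * Complex.I * (m / M)) = 1 ↔ (M : ℤ) ∣ m := by
    rw [Complex.exp_eq_one_iff]
    constructor
    · rintro ⟨n, hn⟩
      refine ⟨n, ?_⟩
      have h2 : (m / M : ℂ) = n := by
        apply mul_left_cancel₀ Complex.two_pi_I_ne_zero; rw [hn]; ring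
      rw [div_eq_iff hM'] at h2
      have : (m : ℂ) = ((M * n : ℤ) : ℂ) := by push_cast; rw [h2]; ring
      exact_mod_cast this
    · rintro ⟨n, rfl⟩
      exact ⟨n, by push_cast; field_simp⟩
  simp_rw [hpow]
  split_ifs with h
  · simp [hone.2 h]
  · have hne : Complex.exp (2 * π * Complex.I * (m / M)) ≠ 1 := fun h' => h (hone.1 h')
    rw [geom_sum_eq hne, ← Complex.exp_nat_mul]
    have : Complex.exp ((M : ℂ) * (2 * π * Complex.I * (m / M))) = 1 := by
      rw [Complex.exp_eq_one_iff]; exact ⟨m, by field_simp⟩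
    simp [this]

theorem integral_character (m n : ℤ) :
    ∫ a in unitSquare, character m n a = if m = 0 ∧ n = 0 then 1 else 0 := by
  unfold unitSquare character
  rw [Measure.volume_eq_prod, setIntegral_prod_mul
    (fun x : ℝ => Complex.exp (2 * π * Complex.I * (m * x)))
    (fun x : ℝ => Complex.exp (2 * π * Complex.I * (n * x))), integral_exp_Ico, integral_exp_Ico]
  split_ifs <;> simp_all

theorem gridMean_character {M : ℕ} (hM : 0 < M) (m n : ℤ) :
    gridMean M (character m n) = if (M : ℤ) ∣ m ∧ (M : ℤ) ∣ n then 1 else 0 := by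
  have hM' : (M : ℂ) ≠ 0 := by exact_mod_cast hM.ne'
  unfold gridMean character
  rw [Finset.sum_product]
  simp only
  rw [← Finset.sum_mul_sum, sum_exp_range hM, sum_exp_range hM]
  split_ifs <;> simp_all
  field_simp

/-- Integral and grid mean can differ only on a nonzero weight divisible by M, and every such weight
has degree at least 2M. -/
theorem integral_eq_gridMean {M : ℕ} (hM : 0 < M) {f : ℝ × ℝ → ℂ}
    (hf : f ∈ trigPoly (2 * M - 1)) :
    IntegrableOn f unitSquare ∧ ∫ a in unitSquare, f a = gridMean M f := by
  induction hf using Submodule.span_induction with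
  | mem f hf =>
    obtain ⟨m, n, ⟨h₁, h₂, h₃⟩, rfl⟩ := hf
    refine ⟨?_, ?_⟩
    · apply integrableOn_of_bound (continuous_character m n) (C := 1) _ (by simp [volume_unitSquare])
      exact fun a => (norm_character m n a).le
    · rw [integral_character, gridMean_character hM]
      congr 1
      rw [eq_iff_iff]
      constructor
      · rintro ⟨rfl, rfl⟩; simp
      · rintro ⟨⟨u, rfl⟩, ⟨v, rfl⟩⟩
        have hM' : (0 : ℤ) < M := by exact_mod_cast hM
        -- The degree 2M - 1 leaves |v|, |3u + v|, |3u + 2v| ≤ 1. The first two give |3u| ≤ 2, so u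
        -- = 0, and then |2v| ≤ 1.
        have bound {x : ℤ} (hx : |(M : ℤ) * x| ≤ ((2 * M - 1 : ℕ) : ℤ)) : |x| < 2 := by
          rw [abs_mul, abs_of_pos hM'] at hx
          have : (M : ℤ) * |x| < M * 2 := by omega
          exact lt_of_mul_lt_mul_left this hM'.le
        have b₁ := bound h₁
        have b₂ := bound (x := 3 * u + v) (by convert h₂ using 2; ring)
        have b₃ := bound (x := 3 * u + 2 * v) (by convert h₃ using 2; ring)
        rw [abs_lt] at b₁ b₂ b₃
        have hu : u = 0 := by omega
        have hv : v = 0 := by omega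
        simp [hu, hv]
  | zero => exact ⟨integrableOn_zero, by simp [gridMean]⟩
  | add f g _ _ hf hg =>
    refine ⟨hf.1.add hg.1, ?_⟩
    simp only [Pi.add_apply]
    rw [integral_add hf.1 hg.1, hf.2, hg.2]
    simp only [gridMean, Pi.add_apply, Finset.sum_add_distrib, mul_add]
  | smul c f _ hf =>
    refine ⟨hf.1.smul c, ?_⟩
    simp only [Pi.smul_apply]
    rw [integral_smul, hf.2]
    simp only [gridMean, Pi.smul_apply, smul_eq_mul, ← Finset.mul_sum]
    ring

/-! ### Orbits of grid points -/

theorem toTorus_add_latticePoint (a : ℝ × ℝ) (k : ℤ × ℤ) :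
    toTorus (a + latticePoint k) = toTorus a := by
  have h (x : ℝ) (n : ℤ) : ((x + n : ℝ) : UnitAddCircle) = x := by
    rw [AddCircle.coe_add]
    rw [show ((n : ℝ) : UnitAddCircle) = 0 from (AddCircle.coe_eq_zero_iff 1).2 ⟨n, by simp⟩,
      add_zero]
  simp [toTorus, latticePoint, h]

theorem exists_scaled_latticePoint (M : ℕ) {w : (ℝ × ℝ) ≃ₗ[ℝ] (ℝ × ℝ)} (hw : w ∈ weylGroup)
    (k l : ℤ × ℤ) (hM : 0 < M) :
    ∃ k', w ((M : ℝ)⁻¹ • latticePoint k) + latticePoint l = (M : ℝ)⁻¹ • latticePoint k' := by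
  obtain ⟨k', hk'⟩ := weylGroup_latticePoint hw k
  have hM' : (M : ℝ) ≠ 0 := by exact_mod_cast hM.ne'
  refine ⟨(k'.1 + M * l.1, k'.2 + M * l.2), ?_⟩
  rw [map_smul, hk']
  ext <;> simp [latticePoint] <;> field_simp

theorem gridPoint_eq_smul (M : ℕ) (j : ℕ × ℕ × ℕ) :
    gridPoint M j = (M : ℝ)⁻¹ • latticePoint (2 * j.2.1 + 3 * j.2.2, j.2.1 + 2 * j.2.2) := by
  ext <;> simp [gridPoint, latticePoint] <;> ring

theorem gridPoint_mem_alcove {M : ℕ} (hM : 0 < M) {j : ℕ × ℕ × ℕ} (hj : j ∈ indexSet M) :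
    gridPoint M j ∈ alcove := by
  rw [mem_indexSet] at hj
  have hM' : (0 : ℝ) < M := by exact_mod_cast hM
  have hj' : (j.1 : ℝ) + 2 * j.2.1 + 3 * j.2.2 = M := by exact_mod_cast hj
  refine ⟨?_, ?_, ?_⟩
  · have : 2 * (gridPoint M j).2 - (gridPoint M j).1 = j.2.2 / M := by simp [gridPoint]; ring
    rw [this]; positivity
  · have : 2 * (gridPoint M j).1 - 3 * (gridPoint M j).2 = j.2.1 / M := by simp [gridPoint]; ring
    rw [this]; positivity
  · rw [gridPoint, div_le_one hM']
    have : (0 : ℝ) ≤ j.1 := Nat.cast_nonneg _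
    linarith

/-- The entries of the index are the slacks of the three alcove inequalities, multiplied by M. -/
theorem exists_gridPoint_eq {M : ℕ} (hM : 0 < M) (k : ℤ × ℤ)
    (h : (M : ℝ)⁻¹ • latticePoint k ∈ alcove) :
    ∃ j ∈ indexSet M, gridPoint M j = (M : ℝ)⁻¹ • latticePoint k := by
  have hM' : (0 : ℝ) < M := by exact_mod_cast hM
  obtain ⟨h₁, h₂, h₃⟩ := h
  simp only [Prod.smul_fst, Prod.smul_snd, latticePoint, smul_eq_mul] at h₁ h₂ h₃
  have g₁ : 0 ≤ 2 * k.2 - k.1 := by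
    have : 0 ≤ (M : ℝ)⁻¹ * ((2 * k.2 - k.1 : ℤ) : ℝ) := by push_cast; linarith
    exact_mod_cast nonneg_of_mul_nonneg_right this (inv_pos.2 hM')
  have g₂ : 0 ≤ 2 * k.1 - 3 * k.2 := by
    have : 0 ≤ (M : ℝ)⁻¹ * ((2 * k.1 - 3 * k.2 : ℤ) : ℝ) := by push_cast; linarith
    exact_mod_cast nonneg_of_mul_nonneg_right this (inv_pos.2 hM')
  have g₃ : k.1 ≤ M := by
    rw [inv_mul_le_iff₀ hM', mul_one] at h₃
    exact_mod_cast h₃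
  obtain ⟨s₂, hs₂⟩ := Int.eq_ofNat_of_zero_le g₁
  obtain ⟨s₁, hs₁⟩ := Int.eq_ofNat_of_zero_le g₂
  obtain ⟨s₀, hs₀⟩ := Int.eq_ofNat_of_zero_le (sub_nonneg.2 g₃)
  refine ⟨(s₀, s₁, s₂), ?_, ?_⟩
  · rw [mem_indexSet]; dsimp only; omega
  · rw [gridPoint_eq_smul]
    congr 2
    ext <;> dsimp only <;> omega

theorem gridPoint_injOn {M : ℕ} (hM : 0 < M) : InjOn (gridPoint M) (indexSet M) := by
  intro j hj j' hj' h
  have hM' : (M : ℝ) ≠ 0 := by exact_mod_cast hM.ne'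
  rw [SetLike.mem_coe, mem_indexSet] at hj hj'
  have h₁ := congrArg Prod.fst h
  have h₂ := congrArg Prod.snd h
  simp only [gridPoint, div_left_inj' hM'] at h₁ h₂
  have h₁' : 2 * j.2.1 + 3 * j.2.2 = 2 * j'.2.1 + 3 * j'.2.2 := by exact_mod_cast h₁
  have h₂' : j.2.1 + 2 * j.2.2 = j'.2.1 + 2 * j'.2.2 := by exact_mod_cast h₂
  ext <;> omega

theorem node_injOn {M : ℕ} (hM : 0 < M) : InjOn (node M) (indexSet M) := fun _ hj _ hj' h =>
  gridPoint_injOn hM hj hj' (X_injOn (gridPoint_mem_alcove hM hj) (gridPoint_mem_alcove hM hj') h)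

/-- Every grid point is equivalent to one in the alcove. -/
theorem exists_weylGroup_gridPoint {M : ℕ} (hM : 0 < M) (k : ℤ × ℤ) : ∃ j ∈ indexSet M,
    ∃ w ∈ weylGroup, ∃ l, w ((M : ℝ)⁻¹ • latticePoint k) + latticePoint l = gridPoint M j := by
  obtain ⟨i, -, i', -, l, hl⟩ := exists_mem_alcove ((M : ℝ)⁻¹ • latticePoint k)
  obtain ⟨k', hk'⟩ := exists_scaled_latticePoint M (weylElt_mem i i') k l hM
  rw [hk'] at hl
  obtain ⟨j, hj, hjk⟩ := exists_gridPoint_eq hM k' hl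
  exact ⟨j, hj, _, weylElt_mem i i', l, hk'.trans hjk.symm⟩

/-- The indices of the grid points of the unit square at which `X` takes the value `y`. -/
def gridFiber (M : ℕ) (y : ℝ × ℝ) : Finset (ℕ × ℕ) :=
  open Classical in
  (Finset.range M ×ˢ Finset.range M).filter fun k => X (k.1 / M, k.2 / M) = y

theorem natGrid_eq_smul (M : ℕ) (k : ℕ × ℕ) :
    ((k.1 / M, k.2 / M) : ℝ × ℝ) = (M : ℝ)⁻¹ • latticePoint (k.1, k.2) := by
  ext <;> simp [latticePoint] <;> ring

theorem toTorus_injOn_grid {M : ℕ} (hM : 0 < M) :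
    InjOn (fun k : ℕ × ℕ => toTorus (k.1 / M, k.2 / M))
      (Finset.range M ×ˢ Finset.range M : Finset (ℕ × ℕ)) := by
  have hM' : (0 : ℝ) < M := by exact_mod_cast hM
  have inj {m n : ℕ} (hm : m < M) (hn : n < M)
      (h : ((m / M : ℝ) : UnitAddCircle) = ((n / M : ℝ) : UnitAddCircle)) : m = n := by
    have mem {m : ℕ} (hm : m < M) : (m / M : ℝ) ∈ Ico (0 : ℝ) (0 + 1) := by
      refine ⟨by positivity, ?_⟩
      rw [zero_add, div_lt_one hM']; exact_mod_cast hm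
    have := (AddCircle.coe_eq_coe_iff_of_mem_Ico (mem hm) (mem hn)).1 h
    rw [div_left_inj' hM'.ne'] at this
    exact_mod_cast this
  intro k hk k' hk' h
  simp only [Finset.coe_product, Finset.coe_range, mem_prod, mem_Iio] at hk hk'
  exact Prod.ext (inj hk.1 hk'.1 (congrArg Prod.fst h)) (inj hk.2 hk'.2 (congrArg Prod.snd h))

/-- The fibre is one Weyl orbit on the torus. Invariance of `X` gives one inclusion; conversely a
point of the fibre can be moved into the alcove, where injectivity of `X` identifies it with the
grid point of `j`. -/
theorem card_gridFiber {M : ℕ} (hM : 0 < M) {j : ℕ × ℕ × ℕ} (hj : j ∈ indexSet M) :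
    (gridFiber M (node M j)).card = ε M j := by
  have himg : {t : UnitAddCircle × UnitAddCircle | ∃ w ∈ weylGroup, toTorus (w (gridPoint M j)) = t}
      = (fun k : ℕ × ℕ => toTorus (k.1 / M, k.2 / M)) '' (gridFiber M (node M j) : Set (ℕ × ℕ)) := by
    ext t
    constructor
    · rintro ⟨w, hw, rfl⟩
      obtain ⟨k, hk⟩ := exists_scaled_latticePoint M hw
        (2 * j.2.1 + 3 * j.2.2, j.2.1 + 2 * j.2.2) 0 hM
      have hk' : w (gridPoint M j) = (M : ℝ)⁻¹ • latticePoint k := by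
        rw [← hk, gridPoint_eq_smul, left_eq_add]; simp [latticePoint]
      have hpos : (0 : ℤ) < M := by exact_mod_cast hM
      have nn (x : ℤ) : ((x % M).toNat : ℤ) = x % M := Int.toNat_of_nonneg (Int.emod_nonneg x hpos.ne')
      -- Reducing the numerators modulo M picks the representative in the unit square.
      have hred : (((k.1 % M).toNat / M, (k.2 % M).toNat / M) : ℝ × ℝ)
          + latticePoint (k.1 / M, k.2 / M) = w (gridPoint M j) := by
        have red (x : ℤ) : ((x % M).toNat / M : ℝ) + ((x / M : ℤ) : ℝ) = (M : ℝ)⁻¹ * x := by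
          have h : (((x % M).toNat : ℤ) : ℝ) + M * ((x / M : ℤ) : ℝ) = x := by
            rw [nn]; exact_mod_cast Int.emod_add_mul_ediv x M
          rw [← h]; push_cast; field_simp
        rw [hk']
        ext
        · exact red k.1
        · exact red k.2
      refine ⟨((k.1 % M).toNat, (k.2 % M).toNat), ?_, ?_⟩
      · have lt (x : ℤ) : (x % M).toNat < M := by
          have := Int.emod_lt_of_pos x hpos
          have := nn x
          omega
        simp only [gridFiber, Finset.coe_filter, Finset.mem_product, Finset.mem_range, mem_ofPred_eq]
        refine ⟨⟨lt _, lt _⟩, ?_⟩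
        rw [← X_add_latticePoint _ (k.1 / M, k.2 / M), hred, X_weylGroup hw]; rfl
      · dsimp only
        rw [← toTorus_add_latticePoint _ (k.1 / M, k.2 / M), hred]
    · rintro ⟨k, hk, rfl⟩
      simp only [gridFiber, Finset.coe_filter, Finset.mem_product, Finset.mem_range,
        mem_ofPred_eq] at hk
      obtain ⟨j', hj', w, hw, l, hl⟩ := exists_weylGroup_gridPoint hM (k.1, k.2)
      have hn : node M j' = node M j := by
        rw [← hk.2, natGrid_eq_smul, ← X_weylGroup hw, ← X_add_latticePoint _ l, hl]; rfl
      have hjj : j' = j := node_injOn hM hj' hj hn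
      obtain ⟨l', hl'⟩ := weylGroup_latticePoint (inv_mem hw) l
      refine ⟨w⁻¹, inv_mem hw, ?_⟩
      dsimp only
      rw [← hjj, ← hl, map_add, hl', toTorus_add_latticePoint, ← LinearEquiv.mul_apply,
        inv_mul_cancel, natGrid_eq_smul]
      rfl
  rw [ε, orbitSize, himg, InjOn.ncard_image, ncard_coe_finset]
  refine (toTorus_injOn_grid hM).mono (Finset.coe_subset.2 ?_)
  rw [gridFiber]
  exact Finset.filter_subset _ _

theorem gridMean_comp_X {M : ℕ} (hM : 0 < M) (f : ℝ × ℝ → ℂ) :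
    gridMean M (fun a => f (X a))
      = 1 / (M : ℂ) ^ 2 * ∑ j ∈ indexSet M, (ε M j : ℂ) * f (node M j) := by
  classical
  rw [gridMean]
  congr 1
  have h (j) (hj : j ∈ indexSet M) : (ε M j : ℂ) * f (node M j)
      = ∑ k ∈ Finset.range M ×ˢ Finset.range M,
          if X (k.1 / M, k.2 / M) = node M j then f (X (k.1 / M, k.2 / M)) else 0 := by
    rw [← card_gridFiber hM hj, ← nsmul_eq_mul, ← Finset.sum_const, gridFiber, Finset.sum_filter]
    refine Finset.sum_congr (by congr) fun k _ => ?_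
    split_ifs with hk
    · rw [hk]
    · rfl
  rw [Finset.sum_congr rfl h, Finset.sum_comm]
  refine Finset.sum_congr rfl fun k _ => ?_
  obtain ⟨j, hj, w, hw, l, hl⟩ := exists_weylGroup_gridPoint hM (k.1, k.2)
  have hn : X (k.1 / M, k.2 / M) = node M j := by
    rw [natGrid_eq_smul, ← X_weylGroup hw, ← X_add_latticePoint _ l, hl]; rfl
  rw [Finset.sum_eq_single_of_mem j hj, if_pos hn]
  intro j' hj' hne
  exact if_neg fun h' => hne (node_injOn hM hj' hj (h'.symm.trans hn))

/-! ### The cubature rule -/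

theorem continuous_of_mem_trigPoly {N : ℕ} {f : ℝ × ℝ → ℂ} (hf : f ∈ trigPoly N) :
    Continuous f := by
  induction hf using Submodule.span_induction with
  | mem f hf => obtain ⟨m, n, -, rfl⟩ := hf; exact continuous_character m n
  | zero => exact continuous_zero
  | add f g _ _ hf hg => exact hf.add hg
  | smul c f _ hf => exact hf.const_smul c

theorem bounded_of_mem_trigPoly {N : ℕ} {f : ℝ × ℝ → ℂ} (hf : f ∈ trigPoly N) :
    ∃ C, ∀ a, ‖f a‖ ≤ C := by
  induction hf using Submodule.span_induction with
  | mem f hf => obtain ⟨m, n, -, rfl⟩ := hf; exact ⟨1, fun a => (norm_character m n a).le⟩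
  | zero => exact ⟨0, by simp⟩
  | add f g _ _ hf hg =>
    obtain ⟨C, hC⟩ := hf
    obtain ⟨D, hD⟩ := hg
    exact ⟨C + D, fun a => (norm_add_le _ _).trans (add_le_add (hC a) (hD a))⟩
  | smul c f _ hf =>
    obtain ⟨C, hC⟩ := hf
    exact ⟨‖c‖ * C, fun a => (norm_smul_le _ _).trans
      (mul_le_mul_of_nonneg_left (hC a) (norm_nonneg c))⟩

theorem evalAt_X_mem_trigPoly {N : ℕ} {p : MvPolynomial (Fin 2) ℂ} (hp : p ∈ polySpace N) :
    (fun a => evalAt p (X a)) ∈ trigPoly N := by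
  have h : (fun a => evalAt p (X a)) = ∑ d ∈ p.support,
      p.coeff d • ((fun a => (X₁ a : ℂ)) ^ d 0 * (fun a => (X₂ a : ℂ)) ^ d 1) := by
    ext a
    simp [evalAt, MvPolynomial.eval_eq', Fin.prod_univ_two, X]
  rw [h]
  refine sum_mem fun d hd => Submodule.smul_mem _ _ (trigPoly_mono ?_
    (mul_mem_trigPoly (pow_mem_trigPoly X₁_mem_trigPoly _) (pow_mem_trigPoly X₂_mem_trigPoly _)))
  have hle := (MvPolynomial.le_weightedTotalDegree ![3, 2] hd).trans hp
  simpa [Finsupp.weight_apply, Finsupp.sum_fintype, mul_comm] using hle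

theorem integral_unitSquare_comp_X {f : ℝ × ℝ → ℂ} (hc : Continuous fun a => f (X a)) {C : ℝ}
    (hC : ∀ a, ‖f (X a)‖ ≤ C) :
    ∫ a in unitSquare, f (X a) = 12 * ∫ a in alcove, f (X a) := by
  have i₁ := integrableOn_of_bound hc hC (s := unitSquare) (by simp [volume_unitSquare])
  have i₂ := integrableOn_of_bound hc hC volume_alcove_ne_top
  have hre := integral_unitSquare_eq (h := fun a => (f (X a)).re)
    (Complex.continuous_re.comp hc) (fun a => (Complex.abs_re_le_norm _).trans (hC a))
    (fun w hw a => by rw [X_weylGroup hw]) (fun a k => by rw [X_add_latticePoint])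
  have him := integral_unitSquare_eq (h := fun a => (f (X a)).im)
    (Complex.continuous_im.comp hc) (fun a => (Complex.abs_im_le_norm _).trans (hC a))
    (fun w hw a => by rw [X_weylGroup hw]) (fun a k => by rw [X_add_latticePoint])
  have r₁ := integral_re i₁
  have r₂ := integral_re i₂
  have m₁ := integral_im i₁
  have m₂ := integral_im i₂
  simp only [RCLike.re_eq_complex_re, RCLike.im_eq_complex_im]
    at r₁ r₂ m₁ m₂
  apply Complex.ext
  · rw [← r₁, hre, r₂]; simp
  · rw [← m₁, him, m₂]; simp

end G2Cubature

end

theorem mainTheorem4 (M : ℕ) (hM : 0 < M) (p : MvPolynomial (Fin 2) ℂ)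
    (hp : p ∈ G2Cubature.polySpace (2 * M - 1)) :
    MeasureTheory.IntegrableOn
        (fun y : ℝ × ℝ =>
          G2Cubature.evalAt p y * ((G2Cubature.K y ^ (-(1 / 2) : ℝ) : ℝ) : ℂ))
        G2Cubature.Ω MeasureTheory.volume ∧
      ∫ y in G2Cubature.Ω,
          G2Cubature.evalAt p y * ((G2Cubature.K y ^ (-(1 / 2) : ℝ) : ℝ) : ℂ) =
        ((Real.pi ^ 2 / (3 * (M : ℝ) ^ 2) : ℝ) : ℂ) *
          ∑ j ∈ G2Cubature.indexSet M,
            (G2Cubature.ε M j : ℂ) * G2Cubature.evalAt p (G2Cubature.node M j) := by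
  have hf := G2Cubature.evalAt_X_mem_trigPoly hp
  have hc := G2Cubature.continuous_of_mem_trigPoly hf
  obtain ⟨C, hC⟩ := G2Cubature.bounded_of_mem_trigPoly hf
  refine ⟨?_, ?_⟩
  · rw [G2Cubature.integrableOn_Ω_iff]
    exact (G2Cubature.integrableOn_of_bound hc hC G2Cubature.volume_alcove_ne_top).const_mul _
  · have h := G2Cubature.integral_unitSquare_comp_X hc hC
    rw [(G2Cubature.integral_eq_gridMean hM hf).2, G2Cubature.gridMean_comp_X hM] at h
    have hM' : (M : ℂ) ≠ 0 := by exact_mod_cast hM.ne'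
    rw [G2Cubature.integral_Ω_eq]
    push_cast
    -- The factor is the Jacobian constant 4π² divided by the order 12 of the Weyl group.
    linear_combination (norm := (field_simp; ring)) (-(Real.pi : ℂ) ^ 2 / 3) * h
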